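/- Let $R=\mathbb Z[[q]][q^{-1}]$ be the ring of Laurent series in $q$ with integer coefficients. For a partition $\lambda=(\lambda_1\ge\lambda_2\ge\cdots)$ of $|\lambda|=\sum_i\lambda_i$, with $m_i(\lambda)$ the multiplicity of the part $i\ge 1$ in $\lambda$, put $$a_\lambda(q)=q^{|\lambda|+2n(\lambda)}\prod_{i\ge1}\prod_{j=1}^{m_i(\lambda)}(1-q^{-j}),\qquad n(\lambda)=\sum_{i\ge1}(i-1)\lambda_i .$$ This is a unit of $R$. Consider the coloring data whose colors are all partitions of non-negative integers, with degree $|\lambda|$ and weight $W(\lambda)=a_\lambda(q)^{-1}\in R$, and let $$Z_C(\bullet,q,T)=\sum_\lambda W(\lambda)\,T^{|\lambda|}\in R[[T]]$$ be the coloring zeta function of a point. Infinite products in $R[[T]]$ are taken with respect to coefficientwise convergence in $T$ and the $q$-adic topology of $R$. Then: 1. If $F$ is a finite field, $n\ge0$, $\lambda$ is a partition of $n$, and $g\in \mathrm{GL}_n(F)$ is conjugate to the direct sum of the unipotent (eigenvalue $1$) Jordan blocks of sizes $\lambda_1,\lambda_2,\dots$, then the centralizer of $g$ in $\mathrm{GL}_n(F)$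 has order $a_\lambda(|F|)$, that is, the value of $a_\lambda(q)$ at $q=|F|$. 2. $\displaystyle Z_C(\bullet,q,T)=\prod_{n\ge0}(1-q^nT)$ in $R[[T]]$. 3. (Euler) $\displaystyle \sum_{n\ge0}\frac{q^{n(n+1)/2}\,T^n}{\prod_{i=1}^n(q^i-1)}=\prod_{n\ge1}(1-q^nT)$ in $R[[T]]$. 4. For every finite field $F$ and every $n\ge0$, the number of unipotent matrices in $\mathrm{GL}_n(F)$ is $|F|^{n^2-n}$. -/

import Mathlib

namespace ColoringZeta

open Filter

/-! ### The ring of Laurent series in `q` -/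

/-- `R = ℤ[[q]][q⁻¹]`. -/
abbrev R : Type := LaurentSeries ℤ

/-- The variable `q`, as a unit of `R`. -/
noncomputable def q : Rˣ where
  val := HahnSeries.single 1 1
  inv := HahnSeries.single (-1) 1
  val_inv := by simp
  inv_val := by simp

theorem isUnit_one_sub_q_pow (j : ℕ) : IsUnit (1 - (q : R) ^ (j + 1)) := by
  have h : IsUnit (1 - (PowerSeries.X : PowerSeries ℤ) ^ (j + 1)) := by
    rw [PowerSeries.isUnit_iff_constantCoeff]
    simp
  have h2 := h.map (HahnSeries.ofPowerSeries ℤ ℤ)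
  simpa [q] using h2

theorem isUnit_q_pow_sub_one (j : ℕ) : IsUnit ((q : R) ^ (j + 1) - 1) := by
  have h := (isUnit_one_sub_q_pow j).neg
  rwa [neg_sub] at h

theorem isUnit_one_sub_q_inv_pow (j : ℕ) : IsUnit (1 - ((q⁻¹ : Rˣ) : R) ^ (j + 1)) := by
  have h : 1 - ((q⁻¹ : Rˣ) : R) ^ (j + 1)
      = ((q⁻¹ ^ (j + 1) : Rˣ) : R) * ((q : R) ^ (j + 1) - 1) := by
    rw [mul_sub, mul_one, Units.val_pow_eq_pow_val, ← mul_pow, Units.inv_mul, one_pow]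
  rw [h]
  exact (Units.isUnit _).mul (isUnit_q_pow_sub_one j)

/-- `HasFormalProd f g` says that `∏ f n` converges unconditionally to `g` in `R[[T]]`, where
`R = ℤ[[q]][q⁻¹]` has the `q`-adic topology and `R[[T]]` the topology of coefficientwise
convergence: for every `k` and `m`, the coefficient of `T ^ k` in every sufficiently large finite
partial product agrees with that of `g` modulo `q ^ m ℤ[[q]]`. -/
def HasFormalProd (f : ℕ → PowerSeries R) (g : PowerSeries R) : Prop :=
  ∀ (k : ℕ) (m : ℤ), ∀ᶠ S : Finset ℕ in atTop, ∀ j : ℤ, j < m →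
    (PowerSeries.coeff k (∏ n ∈ S, f n)).coeff j = (PowerSeries.coeff k g).coeff j

/-! ### Coloring data and the coloring zeta function of a point -/

/-- Colors with a degree function and a weight function with values in `R`. -/
structure ColoringData where
  Color : Type
  degree : Color → ℕ
  finite_degree : ∀ n, {c | degree c = n}.Finite
  zero : Color
  degree_eq_zero_iff : ∀ c, degree c = 0 ↔ c = zero
  weight : Color → R
  weight_zero : weight zero = 1

/-- `Z_C(•, q, T) = ∑ W(c) T ^ |c|`, the sum being over all colors `c`. -/
noncomputable def ColoringData.zetaPoint (D : ColoringData) : PowerSeries R :=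
  PowerSeries.mk fun n => ∑ c ∈ (D.finite_degree n).toFinset, D.weight c

/-! ### Partitions and the functions `a_p(q)` -/

/-- The parts `p₁ ≥ p₂ ≥ ⋯` of a partition, in decreasing order. -/
def sortedParts {n : ℕ} (p : n.Partition) : List ℕ := p.parts.sort (· ≥ ·)

/-- `n(p) = ∑ (i - 1) p_i` (the list is indexed from `0` here). -/
def nStat {n : ℕ} (p : n.Partition) : ℕ :=
  ∑ i : Fin (sortedParts p).length, (i : ℕ) * (sortedParts p).get i

/-- `φ_m(x) = (1 - x)(1 - x²)⋯(1 - x ^ m)`. -/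
def phi {A : Type*} [CommRing A] (m : ℕ) (x : A) : A :=
  ∏ j ∈ Finset.range m, (1 - x ^ (j + 1))

/-- `b_p(x) = ∏_{i ≥ 1} φ_{m_i(p)}(x)`, with `m_i(p)` the multiplicity of `i` in `p`; the factors
with `i > n` are `1`. -/
def bPart {A : Type*} [CommRing A] {n : ℕ} (p : n.Partition) (x : A) : A :=
  ∏ i ∈ Finset.Icc 1 n, phi (p.parts.count i) x

/-- `a_p(x) = x ^ (|p| + 2 n(p)) b_p(x⁻¹)`, for an invertible `x`. -/
def aPart {A : Type*} [CommRing A] {n : ℕ} (p : n.Partition) (x : Aˣ) : A :=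
  (x : A) ^ (n + 2 * nStat p) * bPart p ((x⁻¹ : Aˣ) : A)

theorem isUnit_aPart {n : ℕ} (p : n.Partition) : IsUnit (aPart p q) := by
  unfold aPart bPart phi
  refine (q.isUnit.pow _).mul ?_
  rw [IsUnit.prod_iff]
  intro i _
  rw [IsUnit.prod_iff]
  intro j _
  exact isUnit_one_sub_q_inv_pow j

/-- The weight `W(p) = a_p(q)⁻¹ ∈ R`. -/
noncomputable def partitionWeight {n : ℕ} (p : n.Partition) : R :=
  (((isUnit_aPart p).unit⁻¹ : Rˣ) : R)

/-- All partitions of non-negative integers, with `|p|` as degree and weight `a_p(q)⁻¹`. -/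
noncomputable def centralizerData : ColoringData where
  Color := Σ n : ℕ, n.Partition
  degree := fun p => p.1
  finite_degree := fun n => by
    refine (Set.finite_range (fun p : n.Partition => (⟨n, p⟩ : Σ n : ℕ, n.Partition))).subset ?_
    rintro ⟨k, p⟩ h
    obtain rfl : k = n := h
    exact ⟨p, rfl⟩
  zero := ⟨0, Nat.Partition.indiscrete 0⟩
  degree_eq_zero_iff := by
    rintro ⟨k, p⟩
    constructor
    · intro h
      obtain rfl : k = 0 := h
      rw [Subsingleton.elim p (Nat.Partition.indiscrete 0)]
    · intro h
      exact congrArg Sigma.fst h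
  weight := fun p => partitionWeight p.2
  weight_zero := by
    have h : aPart (Nat.Partition.indiscrete 0) q = 1 := by
      have h0 : nStat (Nat.Partition.indiscrete 0) = 0 := by
        refine Finset.sum_eq_zero fun i _ => absurd i.2 ?_
        simp [sortedParts]
      simp [aPart, bPart, h0]
    simp only [partitionWeight]
    rw [Units.val_eq_one, inv_eq_one, ← Units.val_eq_one]
    exact h

/-! ### Euler's series -/

theorem isUnit_eulerDenom (n : ℕ) : IsUnit (∏ i ∈ Finset.range n, ((q : R) ^ (i + 1) - 1)) := by
  rw [IsUnit.prod_iff]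
  intro i _
  exact isUnit_q_pow_sub_one i

/-- `∑ q ^ (n(n+1)/2) T ^ n / ((q ^ n - 1)⋯(q - 1)) ∈ R[[T]]`. -/
noncomputable def eulerSeries : PowerSeries R :=
  PowerSeries.mk fun n =>
    (q : R) ^ (n * (n + 1) / 2) * (((isUnit_eulerDenom n).unit⁻¹ : Rˣ) : R)

/-! ### Unipotent matrices -/

/-- A matrix `g` is unipotent if `g - 1` is nilpotent. -/
def IsUnipotent {F : Type*} [Field F] {n : ℕ} (g : Matrix.GeneralLinearGroup (Fin n) F) : Prop :=
  IsNilpotent ((g : Matrix (Fin n) (Fin n) F) - 1)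

/-- The Jordan block of size `k` with eigenvalue `1`. -/
def jordanBlock (F : Type*) [Field F] (k : ℕ) : Matrix (Fin k) (Fin k) F :=
  Matrix.of fun i j => if i = j ∨ (i : ℕ) + 1 = (j : ℕ) then 1 else 0

/-- The direct sum of the Jordan blocks with eigenvalue `1` and of sizes `p₁ ≥ p₂ ≥ ⋯`. -/
def jordanMatrix (F : Type*) [Field F] {n : ℕ} (p : n.Partition) :
    Matrix (Σ i : Fin (sortedParts p).length, Fin ((sortedParts p).get i))
      (Σ i : Fin (sortedParts p).length, Fin ((sortedParts p).get i)) F :=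
  Matrix.blockDiagonal' fun i => jordanBlock F ((sortedParts p).get i)

/-- `g ∈ GL_n(F)` is conjugate to the direct sum of Jordan blocks attached to `p`; the bijection
`e` numbers the rows and columns of the latter by `0, …, n - 1`. -/
def IsUnipotentOfType {F : Type*} [Field F] {n : ℕ} (g : Matrix.GeneralLinearGroup (Fin n) F)
    (p : n.Partition) : Prop :=
  ∃ (e : (Σ i : Fin (sortedParts p).length, Fin ((sortedParts p).get i)) ≃ Fin n)
    (P : Matrix.GeneralLinearGroup (Fin n) F),
    (g : Matrix (Fin n) (Fin n) F) =
      (P : Matrix (Fin n) (Fin n) F) * Matrix.reindex e e (jordanMatrix F p) *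
        ((P⁻¹ : Matrix.GeneralLinearGroup (Fin n) F) : Matrix (Fin n) (Fin n) F)

/-- The number of elements of a finite field, as a unit of `ℚ`. -/
noncomputable def cardUnit (F : Type*) [Field F] [Finite F] : ℚˣ :=
  Units.mk0 (Nat.card F : ℚ) (Nat.cast_ne_zero.mpr Nat.card_pos.ne')

end ColoringZeta

/-! Both `a_p` and the number of commuting matrices are governed by `|p| + 2 n(p) = ∑ min(p_i,
p_j)`, the quantity `pairMin`.

Centralizers: an endomorphism commuting with a nilpotent Jordan matrix `N` is determined by the
images `s_i` of the block generators. It is invertible exactly when the vectors `N^(m_i - 1) s_i`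
are independent (`jordanTupleEquiv`). Choosing the `s_i` by decreasing block size gives a product of
differences of powers of `|F|` (`natCard_isJordanTuple`), which factors as `a_p(|F|)`
(`prod_sub_eq`).

Zeta function: put `t = q⁻¹`. Removing the first column of a diagram gives a recursion for the sum
of `1 / a_p` over partitions with a given number of parts. A refinement with a free variable `X`
(`sum_weightSum_mul_qBinom`) follows from this recursion and the `q`-Vandermonde identity; `X = 0`
yields `∑ 1 / a_p = t^n / φ_n(t)`. These coefficients, and those of Euler's series, satisfy the
recursion equivalent to `f(T) = (1 - q^c T) f(qT)`, with `c = 0` and `c = 1`. Iterating it produces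
the infinite product (`hasFormalProd_of_coeff`).

Unipotent matrices: `g ↦ g - 1` reduces to nilpotent endomorphisms `A`. Fix a nonzero vector and
follow its orbit `v, Av, A²v, …`: the next vector is either outside the span of the previous ones or
zero, and in the latter case a complement carries a smaller nilpotent endomorphism
(`natCard_isNilpotentShift`). -/

namespace ColoringZeta

/-! ### Partition statistics in terms of the multiset of parts -/

/-- The sum of `min a b` over all pairs of elements of a multiset. -/
def pairMin (s : Multiset ℕ) : ℕ := (s.map fun a => (s.map fun b => min a b).sum).sum

/-- The product of `φ_m(x)` over the multiplicities `m` of the elements of a multiset. -/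
def phiProd {A : Type*} [CommRing A] (s : Multiset ℕ) (x : A) : A :=
  ∏ v ∈ s.toFinset, phi (s.count v) x

@[simp] theorem phi_zero {A : Type*} [CommRing A] (x : A) : phi 0 x = 1 := by simp [phi]

theorem phi_succ {A : Type*} [CommRing A] (m : ℕ) (x : A) :
    phi (m + 1) x = phi m x * (1 - x ^ (m + 1)) := by
  simp [phi, Finset.prod_range_succ]

theorem phiProd_eq_prod {A : Type*} [CommRing A] (s : Multiset ℕ) (x : A) (T : Finset ℕ)
    (h : s.toFinset ⊆ T) : phiProd s x = ∏ v ∈ T, phi (s.count v) x := by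
  refine Finset.prod_subset h fun v _ hv => ?_
  rw [Multiset.count_eq_zero_of_notMem (by simpa using hv), phi_zero]

theorem phiProd_cons {A : Type*} [CommRing A] (a : ℕ) (s : Multiset ℕ) (x : A) :
    phiProd (a ::ₘ s) x = phiProd s x * (1 - x ^ (s.count a + 1)) := by
  have ha : a ∈ (a ::ₘ s).toFinset := by simp
  rw [phiProd_eq_prod s x (a ::ₘ s).toFinset (by simp), phiProd, ← Finset.mul_prod_erase _ _ ha,
    ← Finset.mul_prod_erase _ (fun v => phi (s.count v) x) ha, Multiset.count_cons_self, phi_succ]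
  have : ∏ v ∈ (a ::ₘ s).toFinset.erase a, phi ((a ::ₘ s).count v) x
      = ∏ v ∈ (a ::ₘ s).toFinset.erase a, phi (s.count v) x := by
    refine Finset.prod_congr rfl fun v hv => ?_
    rw [Multiset.count_cons_of_ne (Finset.ne_of_mem_erase hv)]
  rw [this]
  ring

theorem bPart_eq_phiProd {A : Type*} [CommRing A] {n : ℕ} (p : n.Partition) (x : A) :
    bPart p x = phiProd p.parts x := by
  refine (phiProd_eq_prod _ _ _ fun v hv => ?_).symm
  have hv' : v ∈ p.parts := by simpa using hv
  exact Finset.mem_Icc.2 ⟨p.parts_pos hv', p.le_of_mem_parts hv'⟩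

theorem pairMin_cons_of_forall_le (a : ℕ) (s : Multiset ℕ) (h : ∀ b ∈ s, b ≤ a) :
    pairMin (a ::ₘ s) = a + 2 * s.sum + pairMin s := by
  have h1 : s.map (fun b => min a b) = s := by
    conv_rhs => rw [← Multiset.map_id s]
    exact Multiset.map_congr rfl fun b hb => min_eq_right (h b hb)
  have h2 : s.map (fun b => min b a + (s.map fun c => min b c).sum)
      = s.map (fun b => b + (s.map fun c => min b c).sum) :=
    Multiset.map_congr rfl fun b hb => by rw [min_eq_left (h b hb)]
  simp only [pairMin, Multiset.map_cons, Multiset.sum_cons, h1, h2, Multiset.sum_map_add,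
    min_self, Multiset.map_id']
  ring

/-- Putting a new largest part in front shifts every index by one, which adds the sum of the old
parts to `n(p)`; `pairMin_cons_of_forall_le` shows the matching growth of `pairMin`. -/
theorem sum_add_two_mul_sum_eq_pairMin (l : List ℕ) (h : l.Pairwise (· ≥ ·)) :
    l.sum + 2 * ∑ i : Fin l.length, (i : ℕ) * l.get i = pairMin l := by
  induction l with
  | nil => simp [pairMin]
  | cons a l ih =>
    rw [List.pairwise_cons] at h
    have h1 : ∑ i : Fin l.length, l.get i = l.sum := by
      simp [← List.sum_ofFn]
    rw [← Multiset.cons_coe, pairMin_cons_of_forall_le a l h.1, ← ih h.2, Multiset.sum_coe]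
    simp only [List.length_cons, Fin.sum_univ_succ, List.sum_cons]
    simp only [List.get_eq_getElem, Fin.val_zero, Fin.val_succ, List.getElem_cons_succ, add_mul,
      one_mul, zero_mul, Finset.sum_add_distrib] at h1 ⊢
    rw [h1]
    ring

theorem coe_sortedParts {n : ℕ} (p : n.Partition) : (sortedParts p : Multiset ℕ) = p.parts :=
  Multiset.sort_eq _ _

theorem pairwise_sortedParts {n : ℕ} (p : n.Partition) : (sortedParts p).Pairwise (· ≥ ·) :=
  Multiset.pairwise_sort _ _

theorem add_two_mul_nStat {n : ℕ} (p : n.Partition) : n + 2 * nStat p = pairMin p.parts := by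
  have h := sum_add_two_mul_sum_eq_pairMin _ (pairwise_sortedParts p)
  rw [coe_sortedParts] at h
  rw [← h, nStat]
  congr 1
  rw [← Multiset.sum_coe, coe_sortedParts, p.parts_sum]

theorem aPart_eq {A : Type*} [CommRing A] {n : ℕ} (p : n.Partition) (x : Aˣ) :
    aPart p x = (x : A) ^ pairMin p.parts * phiProd p.parts ((x⁻¹ : Aˣ) : A) := by
  rw [aPart, add_two_mul_nStat, bPart_eq_phiProd]

/-! ### Adding a first column to a partition -/

/-- The diagram with parts `s`, with a first column added such that there are `r` more rows. -/
def addColumn (s : Multiset ℕ) (r : ℕ) : Multiset ℕ := s.map (· + 1) + Multiset.replicate r 1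

theorem card_addColumn (s : Multiset ℕ) (r : ℕ) : (addColumn s r).card = s.card + r := by
  simp [addColumn]

theorem sum_addColumn (s : Multiset ℕ) (r : ℕ) : (addColumn s r).sum = s.sum + s.card + r := by
  simp [addColumn, Multiset.sum_map_add]

/-- Regard the new rows as parts `0` before the column is added: then each of the `(s.card + r)²`
pairs has its minimum raised by exactly one. -/
theorem pairMin_addColumn (s : Multiset ℕ) (r : ℕ) :
    pairMin (addColumn s r) = pairMin s + (s.card + r) ^ 2 := by
  have h (a : ℕ) : ((addColumn s r).map fun b => min (a + 1) b).sum
      = (s.map fun b => min a b).sum + (s.card + r) := by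
    have hmin (b : ℕ) : min (a + 1) (b + 1) = min a b + 1 := by omega
    simp [addColumn, Multiset.map_map, hmin, Multiset.sum_map_add, add_assoc]
  rw [pairMin]
  conv_lhs => enter [1, 2]; rw [addColumn]
  simp only [Multiset.map_add, Multiset.map_map, Function.comp_def, h, Multiset.sum_add,
    Multiset.map_replicate, Multiset.sum_replicate, Multiset.sum_map_add, Multiset.map_const']
  simp [pairMin]
  ring

/-- Multiplicities move from `a` to `a + 1`, and the `r` new parts `1` form a separate class because
`0 ∉ s`. -/
theorem phiProd_addColumn {A : Type*} [CommRing A] (s : Multiset ℕ) (hs : 0 ∉ s) (r : ℕ) (x : A) :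
    phiProd (addColumn s r) x = phi r x * phiProd s x := by
  induction s using Multiset.induction_on with
  | empty =>
    induction r with
    | zero => simp [addColumn, phiProd]
    | succ r ih =>
      have : addColumn 0 (r + 1) = 1 ::ₘ addColumn 0 r := by simp [addColumn]
      rw [this, phiProd_cons, ih, phi_succ]
      simp [addColumn, phiProd]
  | cons a s ih =>
    simp only [Multiset.mem_cons, not_or] at hs
    have h1 : addColumn (a ::ₘ s) r = (a + 1) ::ₘ addColumn s r := by simp [addColumn]
    have h2 : (addColumn s r).count (a + 1) = s.count a := by
      rw [addColumn, Multiset.count_add, Multiset.count_map_eq_count' _ _ (add_left_injective 1),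
        Multiset.count_replicate]
      simp [Ne.symm hs.1]
    rw [h1, phiProd_cons, ih hs.2, phiProd_cons, h2, mul_assoc]

theorem filter_map_pred_addColumn (s : Multiset ℕ) (hs : 0 ∉ s) (r : ℕ) :
    ((addColumn s r).map (· - 1)).filter (0 < ·) = s := by
  have h : s.filter (0 < ·) = s := Multiset.filter_eq_self.2 fun a ha =>
    Nat.pos_of_ne_zero fun h0 => hs (h0 ▸ ha)
  have h2 : (Multiset.replicate r 0).filter (0 < ·) = 0 := by
    simpa using fun a => Multiset.eq_of_mem_replicate
  simp [addColumn, Multiset.map_map, Multiset.filter_add, h, h2]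

/-- The parts lost on lowering everything by one are the parts `1`, so the drop in cardinality
recovers `r`. -/
theorem addColumn_filter_map_pred (s : Multiset ℕ) (hs : 0 ∉ s) :
    addColumn ((s.map (· - 1)).filter (0 < ·))
      (s.card - ((s.map (· - 1)).filter (0 < ·)).card) = s := by
  induction s using Multiset.induction_on with
  | empty => simp [addColumn]
  | cons a s ih =>
    simp only [Multiset.mem_cons, not_or] at hs
    have hle : ((s.map (· - 1)).filter (0 < ·)).card ≤ s.card :=
      (Multiset.card_le_card (Multiset.filter_le _ _)).trans (by simp)
    conv_rhs => rw [← ih hs.2]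
    by_cases h : 0 < a - 1
    · have h1 : a - 1 + 1 = a := by omega
      simp [addColumn, h, h1]
    · have h1 : a = 1 := by have := hs.1; omega
      subst h1
      simp [addColumn, Nat.succ_sub hle, Multiset.replicate_succ]

/-- The partition obtained from a partition with at most `k` parts by adding a column of
height `k`. -/
def addColumnPartition {n k : ℕ} (p : n.Partition) (h : p.parts.card ≤ k) :
    (n + k).Partition where
  parts := addColumn p.parts (k - p.parts.card)
  parts_pos := by
    intro i hi
    simp only [addColumn, Multiset.mem_add, Multiset.mem_map, Multiset.mem_replicate] at hi
    omega
  parts_sum := by rw [sum_addColumn, p.parts_sum]; omega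

theorem zero_notMem_parts {n : ℕ} (p : n.Partition) : 0 ∉ p.parts :=
  fun h => (p.parts_pos h).ne rfl

/-- Summing over the partitions of `n + k` into `k` parts is summing over the partitions of `n`
into at most `k` parts. -/
theorem sum_partition_card_eq {A : Type*} [AddCommMonoid A] (f : Multiset ℕ → A) (n k : ℕ) :
    ∑ p : (n + k).Partition with p.parts.card = k, f p.parts
      = ∑ p : n.Partition with p.parts.card ≤ k, f (addColumn p.parts (k - p.parts.card)) := by
  symm
  refine Finset.sum_bij (fun p hp => addColumnPartition p (Finset.mem_filter.1 hp).2) ?_ ?_ ?_ ?_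
  · intro p hp
    have := (Finset.mem_filter.1 hp).2
    simp only [Finset.mem_filter, Finset.mem_univ, true_and, addColumnPartition, card_addColumn]
    omega
  · intro p hp p' hp' h
    have h1 := congrArg Nat.Partition.parts h
    simp only [addColumnPartition] at h1
    ext1
    rw [← filter_map_pred_addColumn p.parts (zero_notMem_parts p) (k - p.parts.card), h1,
      filter_map_pred_addColumn _ (zero_notMem_parts p')]
  · intro p hp
    have hk := (Finset.mem_filter.1 hp).2
    have hle : ((p.parts.map (· - 1)).filter (0 < ·)).card ≤ p.parts.card :=
      (Multiset.card_le_card (Multiset.filter_le _ _)).trans (by simp)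
    have h1 := addColumn_filter_map_pred p.parts (zero_notMem_parts p)
    have h2 := congrArg Multiset.sum h1
    rw [sum_addColumn, p.parts_sum] at h2
    let p' : n.Partition :=
      { parts := (p.parts.map (· - 1)).filter (0 < ·)
        parts_pos := fun hi => (Multiset.mem_filter.1 hi).2
        parts_sum := by omega }
    refine ⟨p', by simpa [p', hk] using hle, ?_⟩
    ext1
    simpa [addColumnPartition, p', hk] using h1
  · intro p hp
    rfl

/-! ### Gaussian binomial coefficients -/

section QBinomial

variable {K : Type*} [Field K] (t : K)

/-- The Gaussian binomial coefficient with upper argument `m`, as a function of `X = t ^ m`. -/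
def qBinom (X : K) (r : ℕ) : K := (∏ i ∈ Finset.range r, (1 - X * t⁻¹ ^ i)) / phi r t

variable {t}

@[simp] theorem qBinom_zero (X : K) : qBinom t X 0 = 1 := by simp [qBinom]

theorem phi_ne_zero (ht : ∀ j : ℕ, 1 - t ^ (j + 1) ≠ 0) (m : ℕ) : phi m t ≠ 0 :=
  Finset.prod_ne_zero_iff.2 fun j _ => ht j

theorem qBinom_one_succ (r : ℕ) : qBinom t 1 (r + 1) = 0 := by
  simp [qBinom, Finset.prod_range_succ']

/-- The `q`-Pascal rule. After cancelling the common product it says `1 - X t = t^(r+1) (1 - X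
t^(-r)) + (1 - t^(r+1))`. -/
theorem qBinom_mul_succ (h0 : t ≠ 0) (ht : ∀ j : ℕ, 1 - t ^ (j + 1) ≠ 0) (X : K) (r : ℕ) :
    qBinom t (X * t) (r + 1) = t ^ (r + 1) * qBinom t X (r + 1) + qBinom t X r := by
  have h1 : ∏ i ∈ Finset.range (r + 1), (1 - X * t * t⁻¹ ^ i)
      = (∏ i ∈ Finset.range r, (1 - X * t⁻¹ ^ i)) * (1 - X * t) := by
    rw [Finset.prod_range_succ']
    congr 1
    · refine Finset.prod_congr rfl fun i _ => ?_
      rw [pow_succ]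
      field_simp
    · simp
  have h2 := phi_ne_zero ht r
  have h3 := ht r
  rw [qBinom, qBinom, qBinom, h1, Finset.prod_range_succ, phi_succ]
  generalize (∏ i ∈ Finset.range r, (1 - X * t⁻¹ ^ i)) = Y
  rw [inv_pow]
  field_simp
  ring

/-- The `q`-Vandermonde identity. -/
theorem qBinom_vandermonde (h0 : t ≠ 0) (ht : ∀ j : ℕ, 1 - t ^ (j + 1) ≠ 0) (X : K) (M k : ℕ) :
    qBinom t (X * t ^ M) k = ∑ x ∈ Finset.HasAntidiagonal.antidiagonal k,
      qBinom t (t ^ M) x.1 * qBinom t X x.2 * t ^ ((x.2 : ℤ) * ((M : ℤ) - x.1)) := by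
  induction M generalizing k with
  | zero =>
    cases k with
    | zero => simp
    | succ k =>
      rw [Finset.Nat.sum_antidiagonal_succ]
      simp [qBinom_one_succ]
  | succ M ih =>
    cases k with
    | zero => simp
    | succ k =>
      rw [pow_succ, ← mul_assoc, qBinom_mul_succ h0 ht, ih, ih,
        Finset.Nat.sum_antidiagonal_succ, Finset.Nat.sum_antidiagonal_succ, mul_add, add_assoc,
        Finset.mul_sum, ← Finset.sum_add_distrib]
      congr 1
      · simp only [qBinom_zero, one_mul]
        rw [mul_left_comm, ← zpow_natCast, ← zpow_add₀ h0]
        congr 2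
        push_cast
        ring
      · refine Finset.sum_congr rfl fun x hx => ?_
        rw [Finset.HasAntidiagonal.mem_antidiagonal] at hx
        rw [qBinom_mul_succ h0 ht]
        -- The `q`-Pascal rule splits the term in two. In the first half `t^(x.1 + 1) * t^x.2 = t^(k
        -- + 1)` matches the first sum; the second half matches the second sum.
        have e1 : t ^ ((x.2 : ℤ) * (((M + 1 : ℕ) : ℤ) - ((x.1 + 1 : ℕ) : ℤ)))
            = t ^ x.2 * t ^ ((x.2 : ℤ) * ((M : ℤ) - ((x.1 + 1 : ℕ) : ℤ))) := by
          rw [← zpow_natCast, ← zpow_add₀ h0]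
          congr 1
          push_cast
          ring
        have e2 : t ^ ((x.2 : ℤ) * (((M + 1 : ℕ) : ℤ) - ((x.1 + 1 : ℕ) : ℤ)))
            = t ^ ((x.2 : ℤ) * ((M : ℤ) - x.1)) := by
          congr 1
          push_cast
          ring
        rw [add_mul, add_mul]
        congr 1
        · rw [e1, ← hx]
          ring
        · rw [e2]

theorem qBinom_pow (h0 : t ≠ 0) (ht : ∀ j : ℕ, 1 - t ^ (j + 1) ≠ 0) (a b : ℕ) :
    qBinom t (t ^ (a + b)) a = phi (a + b) t / (phi a t * phi b t) := by
  have h : (∏ i ∈ Finset.range a, (1 - t ^ (a + b) * t⁻¹ ^ i)) * phi b t = phi (a + b) t := by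
    rw [phi, phi, add_comm a b, Finset.prod_range_add, mul_comm,
      ← Finset.prod_range_reflect (fun i => 1 - t ^ (b + a) * t⁻¹ ^ i)]
    congr 1
    refine Finset.prod_congr rfl fun i hi => ?_
    have hi := Finset.mem_range.1 hi
    congr 1
    rw [show b + a = (b + i + 1) + (a - 1 - i) by omega, pow_add, inv_pow,
      mul_assoc, mul_inv_cancel₀ (pow_ne_zero _ h0), mul_one, add_assoc]
  have h2 := phi_ne_zero ht b
  have h3 := phi_ne_zero ht a
  rw [qBinom, ← h]
  field_simp

theorem qBinom_pow_of_lt (h0 : t ≠ 0) {a b : ℕ} (h : b < a) : qBinom t (t ^ b) a = 0 := by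
  rw [qBinom, Finset.prod_eq_zero (Finset.mem_range.2 h), zero_div]
  rw [inv_pow, mul_inv_cancel₀ (pow_ne_zero _ h0), sub_self]

/-! ### The sum of `1 / a_p` over all partitions of `n` -/

variable (t)

/-- `1 / a_p(t⁻¹)` in terms of the multiset of parts of `p`. -/
def multisetWeight (s : Multiset ℕ) : K := t ^ pairMin s / phiProd s t

/-- The sum of the weights over all partitions of `n` into `k` parts. -/
def weightSum (n k : ℕ) : K :=
  ∑ p : n.Partition with p.parts.card = k, multisetWeight t p.parts

variable {t}

theorem multisetWeight_addColumn (s : Multiset ℕ) (hs : 0 ∉ s) (r : ℕ) :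
    multisetWeight t (addColumn s r)
      = t ^ ((s.card + r) ^ 2) * (multisetWeight t s / phi r t) := by
  rw [multisetWeight, multisetWeight, pairMin_addColumn, phiProd_addColumn s hs, pow_add,
    div_div, mul_comm (phi r t), mul_div_assoc', mul_comm (t ^ pairMin s)]

theorem card_parts_le {n : ℕ} (p : n.Partition) : p.parts.card ≤ n := by
  conv_rhs => rw [← p.parts_sum]
  simpa using Multiset.card_nsmul_le_sum (a := 1) fun x hx => p.parts_pos hx

theorem sum_weight_mul (n : ℕ) (f : ℕ → K) :
    ∑ p : n.Partition, multisetWeight t p.parts * f p.parts.card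
      = ∑ k ∈ Finset.range (n + 1), weightSum t n k * f k := by
  rw [← Finset.sum_fiberwise_of_maps_to (s := Finset.univ) (t := Finset.range (n + 1))
    (g := fun p : n.Partition => p.parts.card)
    fun p _ => Finset.mem_range.2 (Nat.lt_succ_of_le (card_parts_le p))]
  refine Finset.sum_congr rfl fun k _ => ?_
  rw [weightSum, Finset.sum_mul]
  refine Finset.sum_congr rfl fun p hp => ?_
  rw [(Finset.mem_filter.1 hp).2]

/-- Removing the first column leaves a partition of `n` with `j ≤ k` parts and a factor `t^(k²) /
φ_{k-j}(t)`, where `φ_k / φ_{k-j} = φ_j * qBinom t (t^k) j`. For `j > k` the binomial vanishes, so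
`j` may run freely. -/
theorem weightSum_add (h0 : t ≠ 0) (ht : ∀ j : ℕ, 1 - t ^ (j + 1) ≠ 0) (n k : ℕ) :
    weightSum t (n + k) k = t ^ (k ^ 2) / phi k t *
      ∑ j ∈ Finset.range (n + 1), weightSum t n j * (phi j t * qBinom t (t ^ k) j) := by
  rw [weightSum, sum_partition_card_eq, ← sum_weight_mul n fun j => phi j t * qBinom t (t ^ k) j,
    Finset.sum_filter, Finset.mul_sum]
  refine Finset.sum_congr rfl fun p _ => ?_
  have h1 := phi_ne_zero ht
  split_ifs with h
  · obtain ⟨r, rfl⟩ := Nat.exists_eq_add_of_le h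
    rw [multisetWeight_addColumn _ (zero_notMem_parts p), Nat.add_sub_cancel_left, qBinom_pow h0 ht]
    have := h1 r
    have := h1 p.parts.card
    have := h1 (p.parts.card + r)
    field_simp
  · rw [qBinom_pow_of_lt h0 (not_le.1 h)]
    simp

theorem weightSum_succ_zero (n : ℕ) : weightSum t (n + 1) 0 = 0 := by
  refine Finset.sum_eq_zero fun p hp => ?_
  have h := p.parts_sum
  rw [Multiset.card_eq_zero.1 (Finset.mem_filter.1 hp).2] at h
  simp at h

theorem weightSum_zero_zero : weightSum t 0 0 = 1 := by
  rw [weightSum, Finset.sum_filter, Fintype.sum_unique]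
  simp [multisetWeight, pairMin, phiProd]

/-- The variable `X` closes the induction: the recursion `weightSum_add` needs the identity for
smaller `n` at `X = t^k`. By `q`-Vandermonde the right side expands in the `qBinom t X j`, and the
coefficients are compared one by one. -/
theorem sum_weightSum_mul_qBinom (h0 : t ≠ 0) (ht : ∀ j : ℕ, 1 - t ^ (j + 1) ≠ 0) (n : ℕ) (X : K) :
    ∑ j ∈ Finset.range (n + 1), weightSum t n j * (phi j t * qBinom t X j)
      = t ^ n * ((∏ i ∈ Finset.range n, (1 - X * t ^ i)) / phi n t) := by
  induction n using Nat.strong_induction_on generalizing X with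
  | _ n ih =>
  cases n with
  | zero => simp [weightSum_zero_zero]
  | succ n =>
    have hphi := phi_ne_zero ht
    have h1 : (∏ i ∈ Finset.range (n + 1), (1 - X * t ^ i)) / phi (n + 1) t
        = qBinom t (X * t ^ n) (n + 1) := by
      rw [qBinom, ← Finset.prod_range_reflect]
      congr 1
      refine Finset.prod_congr rfl fun i hi => ?_
      have hi := Finset.mem_range.1 hi
      congr 1
      rw [mul_assoc, show n + 1 - 1 - i = n - i by omega]
      congr 1
      rw [inv_pow, eq_mul_inv_iff_mul_eq₀ (pow_ne_zero _ h0), ← pow_add]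
      congr 1
      omega
    rw [h1, qBinom_vandermonde h0 ht, Finset.mul_sum,
      Finset.Nat.sum_antidiagonal_eq_sum_range_succ_mk, ← Finset.sum_range_reflect]
    refine Finset.sum_congr rfl fun a ha => ?_
    have ha := Nat.lt_succ_iff.1 (Finset.mem_range.1 ha)
    -- For `a = n + 1` there are no parts left, and both coefficients vanish.
    obtain rfl | hlt := ha.eq_or_lt
    · simp [weightSum_succ_zero, qBinom_pow_of_lt h0 (Nat.lt_succ_self n)]
    -- The first column has height `j + 1`, and `a` counts the boxes outside it; the induction
    -- hypothesis is used for `a` at `X = t^(j+1)`.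
    obtain ⟨j, rfl⟩ := Nat.exists_eq_add_of_le (Nat.lt_succ_iff.1 hlt)
    rw [show a + j + 1 + 1 - 1 - a = j + 1 by omega, show a + j + 1 - a = j + 1 by omega,
      show a + j + 1 = a + (j + 1) by omega, weightSum_add h0 ht, ih a (by omega), qBinom_pow h0 ht]
    have h2 : (∏ i ∈ Finset.range a, (1 - t ^ (j + 1) * t ^ i)) * phi j t = phi (a + j) t := by
      rw [phi, phi, add_comm a j, Finset.prod_range_add, mul_comm]
      congr 1
      refine Finset.prod_congr rfl fun i hi => ?_
      rw [← pow_add]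
      congr 2
      omega
    have h3 : t ^ (((j + 1 : ℕ) : ℤ) * (((a + j : ℕ) : ℤ) - (a : ℤ))) = t ^ ((j + 1) * j) := by
      rw [← zpow_natCast]
      congr 1
      push_cast
      ring
    have := hphi j
    have := hphi a
    have := hphi (j + 1)
    simp only [h3]
    rw [← h2]
    field_simp
    ring

/-- The sum of `1 / a_p(t⁻¹)` over all partitions `p` of `n`. -/
theorem sum_multisetWeight (h0 : t ≠ 0) (ht : ∀ j : ℕ, 1 - t ^ (j + 1) ≠ 0) (n : ℕ) :
    ∑ p : n.Partition, multisetWeight t p.parts = t ^ n / phi n t := by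
  have h := sum_weightSum_mul_qBinom h0 ht n 0
  have h2 (j : ℕ) : phi j t * qBinom t 0 j = 1 := by
    simp [qBinom, phi_ne_zero ht]
  have h3 := sum_weight_mul (t := t) n fun _ => 1
  simp only [h2] at h
  rw [h] at h3
  simpa [div_eq_mul_inv] using h3

end QBinomial

/-! ### Formal products -/

section FormalProduct

theorem isUnit_X_pow_sub_one (j : ℕ) :
    IsUnit ((PowerSeries.X : PowerSeries ℤ) ^ (j + 1) - 1) := by
  rw [PowerSeries.isUnit_iff_constantCoeff]
  simp

/-- The coefficients of `∏_{n ≥ 0} (1 - q ^ (n + c) T)`, as power series in `q`. -/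
noncomputable def prodCoeff (c : ℕ) : ℕ → PowerSeries ℤ
  | 0 => 1
  | n + 1 => PowerSeries.X ^ (n + c) * prodCoeff c n *
      (((isUnit_X_pow_sub_one n).unit⁻¹ : (PowerSeries ℤ)ˣ) : PowerSeries ℤ)

theorem prodCoeff_succ_mul (c n : ℕ) :
    prodCoeff c (n + 1) * (PowerSeries.X ^ (n + 1) - 1)
      = PowerSeries.X ^ (n + c) * prodCoeff c n := by
  rw [prodCoeff, mul_assoc, IsUnit.val_inv_mul, mul_one]

/-- The factor `1 - q ^ m T`. -/
noncomputable def prodFactor (m : ℕ) : PowerSeries (PowerSeries ℤ) :=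
  1 - PowerSeries.C (PowerSeries.X ^ m) * PowerSeries.X

/-- The functional equation iterated `M` times; the last factor is `f(q^M T)`. -/
theorem mk_prodCoeff_eq (c M : ℕ) :
    PowerSeries.mk (prodCoeff c) = (∏ n ∈ Finset.range M, prodFactor (n + c)) *
      PowerSeries.mk fun n => (PowerSeries.X ^ M) ^ n * prodCoeff c n := by
  induction M with
  | zero => simp
  | succ M ih =>
    rw [ih, Finset.prod_range_succ, mul_assoc]
    congr 1
    ext1 k
    rw [prodFactor, sub_mul, one_mul, map_sub, mul_assoc, PowerSeries.coeff_C_mul]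
    cases k with
    | zero => simp [PowerSeries.coeff_zero_X_mul]
    | succ k =>
      rw [PowerSeries.coeff_succ_X_mul]
      simp only [PowerSeries.coeff_mk]
      have h := prodCoeff_succ_mul c k
      linear_combination (-(PowerSeries.X ^ M) ^ (k + 1)) * h

theorem dvd_coeff_of_C_dvd {A : Type*} [CommRing A] {a : A} {f : PowerSeries A}
    (h : PowerSeries.C a ∣ f) (k : ℕ) : a ∣ PowerSeries.coeff k f := by
  obtain ⟨g, rfl⟩ := h
  rw [PowerSeries.coeff_C_mul]
  exact dvd_mul_right _ _

theorem C_dvd_of_dvd_coeff {A : Type*} [CommRing A] {a : A} {f : PowerSeries A}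
    (h : ∀ k, a ∣ PowerSeries.coeff k f) : PowerSeries.C a ∣ f := by
  choose g hg using h
  refine ⟨PowerSeries.mk g, ?_⟩
  ext1 k
  rw [PowerSeries.coeff_C_mul, PowerSeries.coeff_mk, hg]

/-- Modulo `q^M` both the factors with index outside `range M` and the remainder `f(q^M T)` are `1`.
-/
theorem C_dvd_prod_sub (c M : ℕ) (S : Finset ℕ) (hS : Finset.range M ⊆ S) :
    PowerSeries.C (PowerSeries.X ^ M : PowerSeries ℤ) ∣
      (∏ n ∈ S, prodFactor (n + c)) - PowerSeries.mk (prodCoeff c) := by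
  rw [mk_prodCoeff_eq c M, ← Finset.prod_sdiff hS, mul_comm, ← mul_sub]
  refine Dvd.dvd.mul_left ?_ _
  rw [← sub_sub_sub_cancel_right _ _ 1]
  refine dvd_sub ?_ (C_dvd_of_dvd_coeff fun k => ?_)
  · rw [← Ideal.mem_span_singleton, ← Ideal.Quotient.eq, map_prod, map_one]
    refine Finset.prod_eq_one fun n hn => ?_
    rw [← map_one (Ideal.Quotient.mk _), Ideal.Quotient.eq, Ideal.mem_span_singleton, prodFactor,
      sub_sub_cancel_left, dvd_neg]
    refine Dvd.dvd.mul_right (map_dvd _ (pow_dvd_pow _ ?_)) _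
    have := (Finset.mem_sdiff.1 hn).2
    rw [Finset.mem_range] at this
    omega
  · cases k with
    | zero => simp [prodCoeff]
    | succ k =>
      simp only [map_sub, PowerSeries.coeff_mk, PowerSeries.coeff_one, Nat.succ_ne_zero, if_false,
        sub_zero]
      exact (dvd_pow_self _ k.succ_ne_zero).mul_right _

/-- The inclusion `ℤ[[q]] → R`. -/
noncomputable def laurentHom : PowerSeries ℤ →+* R := HahnSeries.ofPowerSeries ℤ ℤ

@[simp] theorem laurentHom_X : laurentHom PowerSeries.X = (q : R) := by
  simp [laurentHom, q]

theorem coeff_laurentHom_eq_zero {f : PowerSeries ℤ} {M : ℕ} (h : PowerSeries.X ^ M ∣ f) {j : ℤ}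
    (hj : j < M) : (laurentHom f).coeff j = 0 := by
  rcases lt_or_ge j 0 with hj0 | hj0
  · exact HahnSeries.embDomain_of_notMem_range (by rintro ⟨x, hx⟩; simp at hx; omega)
  · lift j to ℕ using hj0
    have h1 := (LaurentSeries.coeff_coe_powerSeries f j)
    rw [laurentHom]
    refine h1.trans ?_
    exact PowerSeries.X_pow_dvd_iff.1 h j (by exact_mod_cast hj)

/-- A power series satisfying the functional equation `f(T) = (1 - q ^ c T) f(q T)` is the product
`∏_{n ≥ 0} (1 - q ^ (n + c) T)`. -/
theorem hasFormalProd_of_coeff (c : ℕ) (e : ℕ → R) (h0 : e 0 = 1)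
    (h : ∀ n, e (n + 1) * ((q : R) ^ (n + 1) - 1) = (q : R) ^ (n + c) * e n) :
    HasFormalProd (fun n => 1 - PowerSeries.C ((q : R) ^ (n + c)) * PowerSeries.X)
      (PowerSeries.mk e) := by
  have he (n : ℕ) : e n = laurentHom (prodCoeff c n) := by
    induction n with
    | zero => simp [h0, prodCoeff]
    | succ n ih =>
      refine (isUnit_q_pow_sub_one n).mul_right_cancel ?_
      rw [h, ih]
      have h1 := congrArg laurentHom (prodCoeff_succ_mul c n)
      simpa using h1.symm
  intro k m
  -- For negative `m` the bound `m.toNat = 0` suffices: both sides come from `ℤ[[q]]` and have no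
  -- negative powers of `q`.
  filter_upwards [Filter.eventually_ge_atTop (Finset.range m.toNat)] with S hS j hj
  have h1 : PowerSeries.map laurentHom (∏ n ∈ S, prodFactor (n + c))
      = ∏ n ∈ S, (1 - PowerSeries.C ((q : R) ^ (n + c)) * PowerSeries.X) := by
    simp [map_prod, prodFactor]
  have h2 := coeff_laurentHom_eq_zero (dvd_coeff_of_C_dvd (C_dvd_prod_sub c m.toNat S hS) k)
    (j := j) (by omega)
  rw [map_sub, map_sub, HahnSeries.coeff_sub, sub_eq_zero, PowerSeries.coeff_mk, ← he] at h2
  rw [← h1, PowerSeries.coeff_map, PowerSeries.coeff_mk, h2]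

theorem hasFormalProd_eulerSeries :
    HasFormalProd (fun n => 1 - PowerSeries.C ((q : R) ^ (n + 1)) * PowerSeries.X)
      eulerSeries := by
  refine hasFormalProd_of_coeff 1 _ (by simp) fun n => ?_
  have h1 := (isUnit_eulerDenom (n + 1)).val_inv_mul
  have h2 := (isUnit_eulerDenom n).val_inv_mul
  have h3 : (((isUnit_eulerDenom (n + 1)).unit⁻¹ : Rˣ) : R) * ((q : R) ^ (n + 1) - 1)
      = (((isUnit_eulerDenom n).unit⁻¹ : Rˣ) : R) := by
    refine (isUnit_eulerDenom n).mul_right_cancel ?_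
    rw [h2]
    refine Eq.trans ?_ h1
    rw [mul_assoc]
    congr 1
    rw [Finset.prod_range_succ, mul_comm]
  have h4 : (n + 1) * (n + 1 + 1) / 2 = (n + 1) + n * (n + 1) / 2 := by
    rw [show (n + 1) * (n + 1 + 1) = n * (n + 1) + (n + 1) * 2 by ring,
      Nat.add_mul_div_right _ _ (by norm_num), add_comm]
  rw [mul_assoc, h3, h4, pow_add, mul_assoc]

theorem hasFormalProd_zetaPoint :
    HasFormalProd (fun n => 1 - PowerSeries.C ((q : R) ^ n) * PowerSeries.X)
      centralizerData.zetaPoint := by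
  -- Identities with denominators `φ_n(t)` are proved in the fraction field and pulled back along
  -- the injection `ι`.
  let K := FractionRing R
  let ι : R →+* K := algebraMap R K
  have hι : Function.Injective ι := IsFractionRing.injective R K
  let t : K := ι ((q⁻¹ : Rˣ) : R)
  have hqt : ι (q : R) * t = 1 := by rw [← map_mul, Units.mul_inv, map_one]
  have h0 : t ≠ 0 := right_ne_zero_of_mul_eq_one hqt
  have ht (j : ℕ) : 1 - t ^ (j + 1) ≠ 0 := by
    have := ((isUnit_one_sub_q_inv_pow j).map ι).ne_zero
    simpa [t] using this
  have hw {n : ℕ} (p : n.Partition) : ι (partitionWeight p) = multisetWeight t p.parts := by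
    have h1 := congrArg ι (isUnit_aPart p).val_inv_mul
    rw [map_mul, map_one] at h1
    have h2 : ι (aPart p q) = ι (q : R) ^ pairMin p.parts * phiProd p.parts t := by
      simp [aPart_eq, phiProd, phi, t, map_prod]
    rw [h2] at h1
    have h3 : phiProd p.parts t ≠ 0 := right_ne_zero_of_mul (right_ne_zero_of_mul_eq_one h1)
    rw [multisetWeight, eq_div_iff h3, partitionWeight]
    have h4 : (ι (q : R) * t) ^ pairMin p.parts = 1 := by rw [hqt, one_pow]
    rw [mul_pow] at h4
    linear_combination t ^ pairMin p.parts * h1 -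
      ι (((isUnit_aPart p).unit⁻¹ : Rˣ) : R) * phiProd p.parts t * h4
  let e (n : ℕ) : R := ∑ p : n.Partition, partitionWeight p
  have he (n : ℕ) : ι (e n) = t ^ n / phi n t := by
    simp only [e, map_sum, hw, sum_multisetWeight h0 ht]
  have hz : centralizerData.zetaPoint = PowerSeries.mk e := by
    ext1 n
    rw [ColoringData.zetaPoint, PowerSeries.coeff_mk, PowerSeries.coeff_mk]
    symm
    refine Finset.sum_bij (fun p _ => (⟨n, p⟩ : Σ n : ℕ, n.Partition)) ?_ ?_ ?_ ?_
    · intro p _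
      exact (Set.Finite.mem_toFinset _).2 rfl
    · intro p _ p' _ h
      exact eq_of_heq (Sigma.mk.inj h).2
    · rintro ⟨k, p⟩ h
      obtain rfl : k = n := (Set.Finite.mem_toFinset (centralizerData.finite_degree n)).1 h
      exact ⟨p, Finset.mem_univ _, rfl⟩
    · intro p _
      rfl
  rw [hz]
  refine hasFormalProd_of_coeff 0 e (hι ?_) fun n => hι ?_
  · rw [he]
    simp
  · rw [map_mul, map_mul, he, he, map_sub, map_pow, map_pow, map_one, phi_succ, add_zero]
    have h1 := phi_ne_zero ht n
    have h2 := ht n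
    have h4 : (ι (q : R) * t) ^ (n + 1) = 1 := by rw [hqt, one_pow]
    have h5 : (ι (q : R) * t) ^ n = 1 := by rw [hqt, one_pow]
    rw [mul_pow] at h4 h5
    rw [div_mul_eq_mul_div, mul_div_assoc', div_eq_div_iff (mul_ne_zero h1 h2) h1]
    linear_combination phi n t * h4 - phi n t * (1 - t ^ (n + 1)) * h5

end FormalProduct

/-! ### Counting nilpotent endomorphisms -/

section Nilpotent

theorem natCard_subtype_eq_sum_fiber {α β : Type*} [Finite α] [Fintype β] (P : α → Prop)
    (g : α → β) : Nat.card {a // P a} = ∑ b, Nat.card {a // P a ∧ g a = b} := by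
  rw [← Nat.card_congr (Equiv.sigmaFiberEquiv fun a : {a // P a} => g a), Nat.card_sigma]
  exact Finset.sum_congr rfl fun b _ =>
    Nat.card_congr (Equiv.subtypeSubtypeEquivSubtypeInter P fun a => g a = b)

variable {F : Type*} [Field F]

/-- The endomorphism of `W × C` with upper triangular block matrix `(J, B; 0, D)`. -/
def blockEnd {W C : Type*} [AddCommGroup W] [Module F W] [AddCommGroup C] [Module F C]
    (J : Module.End F W) (B : C →ₗ[F] W) (D : Module.End F C) : Module.End F (W × C) :=
  (J.coprod B).prod (D ∘ₗ LinearMap.snd F W C)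

@[simp] theorem blockEnd_apply {W C : Type*} [AddCommGroup W] [Module F W] [AddCommGroup C]
    [Module F C] (J : Module.End F W) (B : C →ₗ[F] W) (D : Module.End F C) (x : W × C) :
    blockEnd J B D x = (J x.1 + B x.2, D x.2) := rfl

theorem snd_blockEnd_pow {W C : Type*} [AddCommGroup W] [Module F W] [AddCommGroup C]
    [Module F C] (J : Module.End F W) (B : C →ₗ[F] W) (D : Module.End F C) (m : ℕ) (x : W × C) :
    ((blockEnd J B D ^ m) x).2 = (D ^ m) x.2 := by
  induction m with
  | zero => simp
  | succ m ih => rw [pow_succ', pow_succ', Module.End.mul_apply, Module.End.mul_apply,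
      blockEnd_apply, ih]

theorem blockEnd_pow_inl {W C : Type*} [AddCommGroup W] [Module F W] [AddCommGroup C]
    [Module F C] (J : Module.End F W) (B : C →ₗ[F] W) (D : Module.End F C) (m : ℕ) (w : W) :
    (blockEnd J B D ^ m) (w, 0) = ((J ^ m) w, 0) := by
  induction m with
  | zero => simp
  | succ m ih => rw [pow_succ', pow_succ', Module.End.mul_apply, Module.End.mul_apply, ih]; simp

/-- If `D^m = 0`, the `m`-th power of the block map lands in `W`, where it acts as `J`. -/
theorem isNilpotent_blockEnd_iff {W C : Type*} [AddCommGroup W] [Module F W] [AddCommGroup C]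
    [Module F C] {J : Module.End F W} (hJ : IsNilpotent J) (B : C →ₗ[F] W) (D : Module.End F C) :
    IsNilpotent (blockEnd J B D) ↔ IsNilpotent D := by
  constructor
  · rintro ⟨m, hm⟩
    refine ⟨m, LinearMap.ext fun c => ?_⟩
    rw [← snd_blockEnd_pow J B D m (0, c), hm]
    rfl
  · rintro ⟨m, hm⟩
    obtain ⟨l, hl⟩ := hJ
    refine ⟨l + m, LinearMap.ext fun x => ?_⟩
    have h : (blockEnd J B D ^ m) x = (((blockEnd J B D ^ m) x).1, 0) := by
      ext
      · rfl
      · rw [snd_blockEnd_pow, hm]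
        rfl
    rw [pow_add, Module.End.mul_apply, h, blockEnd_pow_inl, hl]
    rfl

/-- Nilpotent endomorphisms with a given nilpotent restriction to a subspace. -/
def nilpotentExtensionEquiv {V W C : Type*} [AddCommGroup V] [Module F V] [AddCommGroup W]
    [Module F W] [AddCommGroup C] [Module F C] (e : (W × C) ≃ₗ[F] V) {J : Module.End F W}
    (hJ : IsNilpotent J) :
    {A : Module.End F V // IsNilpotent A ∧ ∀ w, A (e (w, 0)) = e (J w, 0)} ≃
      (C →ₗ[F] W) × {D : Module.End F C // IsNilpotent D} where
  toFun A :=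
    let A' := e.symm.conj A.1
    have hA : A' = blockEnd J (LinearMap.fst F W C ∘ₗ A' ∘ₗ LinearMap.inr F W C)
        (LinearMap.snd F W C ∘ₗ A' ∘ₗ LinearMap.inr F W C) := by
      refine LinearMap.prod_ext ?_ ?_
      · ext w <;> simp [A', LinearEquiv.conj_apply, A.2.2]
      · ext w <;> simp
    ⟨LinearMap.fst F W C ∘ₗ A' ∘ₗ LinearMap.inr F W C,
      LinearMap.snd F W C ∘ₗ A' ∘ₗ LinearMap.inr F W C, by
      rw [← isNilpotent_blockEnd_iff hJ, ← hA]
      exact A.2.1.map (e.symm.conjRingEquiv)⟩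
  invFun x := ⟨e.conj (blockEnd J x.1 x.2.1),
    ((isNilpotent_blockEnd_iff hJ x.1 x.2.1).2 x.2.2).map e.conjRingEquiv, fun w => by
      simp [LinearEquiv.conj_apply]⟩
  left_inv A := by
    ext1
    refine LinearMap.ext fun v => ?_
    obtain ⟨⟨w, c⟩, rfl⟩ := e.surjective v
    have h : e (w, c) = e (w, 0) + e (0, c) := by rw [← map_add]; simp
    have h2 : (J w + (e.symm (A.1 (e (0, c)))).1, (e.symm (A.1 (e (0, c)))).2)
      = (J w, 0) + e.symm (A.1 (e (0, c))) := by ext <;> simp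
    simp [LinearEquiv.conj_apply]
    rw [h2, h, map_add, map_add, A.2.2]
    simp
  right_inv x := by
    refine Prod.ext ?_ (Subtype.ext ?_)
    · ext c
      simp [LinearEquiv.conj_apply]
    · ext c
      simp [LinearEquiv.conj_apply]

theorem natCard_nilpotentExtension [Finite F] {V W C : Type*} [AddCommGroup V] [Module F V]
    [AddCommGroup W] [Module F W] [AddCommGroup C] [Module F C] [Module.Finite F W]
    [Module.Finite F C] (e : (W × C) ≃ₗ[F] V) {J : Module.End F W} (hJ : IsNilpotent J) :
    Nat.card {A : Module.End F V // IsNilpotent A ∧ ∀ w, A (e (w, 0)) = e (J w, 0)} =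
      Nat.card F ^ (Module.finrank F C * Module.finrank F W) *
        Nat.card {D : Module.End F C // IsNilpotent D} := by
  rw [Nat.card_congr (nilpotentExtensionEquiv e hJ), Nat.card_prod,
    Module.natCard_eq_pow_finrank (K := F) (V := C →ₗ[F] W), Module.finrank_linearMap]

variable {V : Type*} [AddCommGroup V] [Module F V]

/-- `A` is nilpotent and shifts the vectors of the tuple `v`. -/
def IsNilpotentShift {k : ℕ} (v : Fin (k + 1) → V) (A : Module.End F V) : Prop :=
  IsNilpotent A ∧ ∀ i : Fin k, A (v i.castSucc) = v i.succ

theorem IsNilpotentShift.pow_apply_zero {k : ℕ} {v : Fin (k + 1) → V} {A : Module.End F V}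
    (h : IsNilpotentShift v A) (i : Fin (k + 1)) : v i = (A ^ (i : ℕ)) (v 0) := by
  induction i using Fin.induction with
  | zero => simp
  | succ i ih =>
    rw [← h.2, ih, Fin.val_succ, pow_succ', Module.End.mul_apply, Fin.val_castSucc]

/-- The span is then `A`-stable of dimension `k + 1`, so Cayley–Hamilton for a nilpotent map gives
`A^(k+1) = 0` there, and `A v_k = A^(k+1) v_0`. -/
theorem IsNilpotentShift.apply_last_eq_zero {k : ℕ} {v : Fin (k + 1) → V} {A : Module.End F V}
    (h : IsNilpotentShift v A) (hv : LinearIndependent F v)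
    (hl : A (v (Fin.last k)) ∈ Submodule.span F (Set.range v)) : A (v (Fin.last k)) = 0 := by
  have hW : ∀ x ∈ Submodule.span F (Set.range v), A x ∈ Submodule.span F (Set.range v) := by
    have : Submodule.span F (Set.range v) ≤ (Submodule.span F (Set.range v)).comap A := by
      rw [Submodule.span_le]
      rintro _ ⟨i, rfl⟩
      change A (v i) ∈ Submodule.span F (Set.range v)
      induction i using Fin.lastCases with
      | last => exact hl
      | cast i =>
        rw [h.2]
        exact Submodule.subset_span ⟨_, rfl⟩
    exact this
  have : Module.Finite F (Submodule.span F (Set.range v)) :=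
    Module.Finite.span_of_finite F (Set.finite_range v)
  have hnil : IsNilpotent (A.restrict hW) := by
    obtain ⟨m, hm⟩ := h.1
    refine ⟨m, LinearMap.ext fun x => Subtype.ext ?_⟩
    rw [Module.End.pow_restrict]
    simp [hm]
  have h1 := LinearMap.aeval_self_charpoly (A.restrict hW)
  rw [hnil.charpoly_eq_X_pow_finrank, finrank_span_eq_card hv, Fintype.card_fin, map_pow,
    Polynomial.aeval_X, Module.End.pow_restrict] at h1
  have h2 := congrArg Subtype.val (LinearMap.congr_fun h1 ⟨v 0, Submodule.subset_span ⟨0, rfl⟩⟩)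
  rw [h.pow_apply_zero (Fin.last k), ← Module.End.mul_apply, ← pow_succ']
  exact h2

theorem isNilpotentShift_snoc_iff {k : ℕ} {v : Fin (k + 1) → V} {A : Module.End F V} (u : V) :
    IsNilpotentShift (Fin.snoc v u : Fin (k + 2) → V) A ↔
      IsNilpotentShift v A ∧ A (v (Fin.last k)) = u := by
  rw [IsNilpotentShift, IsNilpotentShift, and_assoc, Fin.forall_fin_succ']
  simp only [Fin.snoc_castSucc, Fin.succ_castSucc, Fin.succ_last, Fin.snoc_last]

/-- The nilpotent shift on the span of a linearly independent tuple. -/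
theorem exists_nilpotent_shift {k : ℕ} {v : Fin (k + 1) → V} (hv : LinearIndependent F v) :
    ∃ J : Module.End F (Submodule.span F (Set.range v)), IsNilpotent J ∧
      (∀ i : Fin k, (J (Module.Basis.span hv i.castSucc) : V) = v i.succ) ∧
      J (Module.Basis.span hv (Fin.last k)) = 0 := by
  let b := Module.Basis.span hv
  let J := b.constr F (Fin.snoc (fun i : Fin k => b i.succ) 0 : Fin (k + 1) → _)
  have h1 (i : Fin k) : J (b i.castSucc) = b i.succ := by
    simp [J]
  have h2 : J (b (Fin.last k)) = 0 := by
    simp [J]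
  refine ⟨J, ⟨k + 1, b.ext fun i => ?_⟩, fun i => ?_, h2⟩
  · have h3 : (J ^ (k + 1 - (i : ℕ))) (b i) = 0 := by
      induction i using Fin.reverseInduction with
      | last => simp [h2]
      | cast i ih =>
        have : k + 1 - (i.castSucc : ℕ) = (k + 1 - (i.succ : ℕ)) + 1 := by
          simp only [Fin.val_castSucc, Fin.val_succ]
          omega
        rw [this, pow_succ, Module.End.mul_apply, h1, ih]
    have h4 : J ^ (k + 1) = J ^ (i : ℕ) * J ^ (k + 1 - (i : ℕ)) := by
      rw [← pow_add]
      congr 1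
      omega
    rw [h4, Module.End.mul_apply, h3, map_zero, LinearMap.zero_apply]
  · rw [h1, Module.Basis.span_apply]

/-- On the span `A` is the prescribed shift `J`; a complement of dimension `d` contributes an
arbitrary map into the span and a nilpotent endomorphism. -/
theorem natCard_isNilpotentShift_last_eq_zero [Finite F] [Module.Finite F V] {k d : ℕ}
    (hd : Module.finrank F V = k + 1 + d)
    (hN : ∀ C : Submodule F V, Module.finrank F C = d →
      Nat.card {D : Module.End F C // IsNilpotent D} = Nat.card F ^ (d * (d - 1)))
    {v : Fin (k + 1) → V} (hv : LinearIndependent F v) :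
    Nat.card {A : Module.End F V // IsNilpotentShift v A ∧ A (v (Fin.last k)) = 0} =
      Nat.card F ^ (d * (k + 1) + d * (d - 1)) := by
  obtain ⟨J, hJ, hJ1, hJ2⟩ := exists_nilpotent_shift hv
  obtain ⟨C, hC⟩ := Submodule.exists_isCompl (Submodule.span F (Set.range v))
  have hW : Module.finrank F (Submodule.span F (Set.range v)) = k + 1 := by
    rw [finrank_span_eq_card hv, Fintype.card_fin]
  have hCd : Module.finrank F C = d := by
    have := Submodule.finrank_add_eq_of_isCompl hC
    omega
  let e := Submodule.prodEquivOfIsCompl _ _ hC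
  have h := natCard_nilpotentExtension e hJ
  rw [hCd, hW, hN C hCd, ← pow_add] at h
  rw [← h]
  refine Nat.card_congr (Equiv.subtypeEquivRight fun A => ?_)
  rw [IsNilpotentShift, and_assoc]
  refine and_congr_right fun _ => ?_
  have he (w : Submodule.span F (Set.range v)) : e (w, 0) = w := by simp [e]
  constructor
  · rintro ⟨h1, h2⟩
    have : A ∘ₗ (Submodule.span F (Set.range v)).subtype
        = (Submodule.span F (Set.range v)).subtype ∘ₗ J := by
      refine (Module.Basis.span hv).ext fun i => ?_
      induction i using Fin.lastCases with
      | last =>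
        rw [LinearMap.comp_apply, LinearMap.comp_apply, hJ2, map_zero, Submodule.subtype_apply,
          Module.Basis.span_apply, h2]
      | cast i =>
        rw [LinearMap.comp_apply, LinearMap.comp_apply, Submodule.subtype_apply,
          Submodule.subtype_apply, hJ1, Module.Basis.span_apply, h1]
    intro w
    rw [he, he]
    exact LinearMap.congr_fun this w
  · intro h1
    simp only [he] at h1
    refine ⟨fun i => ?_, ?_⟩
    · rw [← hJ1, ← h1, Module.Basis.span_apply]
    · have := h1 (Module.Basis.span hv (Fin.last k))
      rwa [hJ2, Module.Basis.span_apply] at this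

/-- Sort by `u = A v_k`; nonzero `u` in the span are impossible by `apply_last_eq_zero`. -/
theorem natCard_isNilpotentShift_eq_add [Finite F] [Module.Finite F V] {k : ℕ}
    {v : Fin (k + 1) → V} (hv : LinearIndependent F v) (Q : ℕ)
    (hQ : ∀ u, u ∉ Submodule.span F (Set.range v) →
      Nat.card {A : Module.End F V // IsNilpotentShift v A ∧ A (v (Fin.last k)) = u} = Q) :
    Nat.card {A : Module.End F V // IsNilpotentShift v A} =
      Nat.card {A : Module.End F V // IsNilpotentShift v A ∧ A (v (Fin.last k)) = 0} +
        Nat.card {u : V // u ∉ Submodule.span F (Set.range v)} * Q := by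
  have : Finite V := Module.finite_of_finite F
  have : Fintype V := Fintype.ofFinite V
  have : Finite (Module.End F V) := Module.finite_of_finite F
  classical
  rw [natCard_subtype_eq_sum_fiber _ fun A : Module.End F V => A (v (Fin.last k))]
  have hzero (u : V) (hu : u ∈ Submodule.span F (Set.range v)) (hu0 : u ≠ 0) :
      Nat.card {A : Module.End F V // IsNilpotentShift v A ∧ A (v (Fin.last k)) = u} = 0 := by
    have : IsEmpty {A : Module.End F V // IsNilpotentShift v A ∧ A (v (Fin.last k)) = u} :=
      ⟨fun A => hu0 (by rw [← A.2.2]; exact A.2.1.apply_last_eq_zero hv (by rwa [A.2.2]))⟩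
    exact Nat.card_of_isEmpty
  generalize hZ :
    Nat.card {A : Module.End F V // IsNilpotentShift v A ∧ A (v (Fin.last k)) = 0} = Z
  have h1 (u : V) :
      Nat.card {A : Module.End F V // IsNilpotentShift v A ∧ A (v (Fin.last k)) = u}
      = (if u = 0 then Z else 0) + if u ∉ Submodule.span F (Set.range v) then Q else 0 := by
    by_cases hu0 : u = 0
    · subst hu0
      simp [hZ]
    · by_cases hu : u ∈ Submodule.span F (Set.range v)
      · simp [hzero u hu hu0, hu0, hu]
      · simp [hQ u hu, hu0, hu]
  rw [Finset.sum_congr rfl fun u _ => h1 u, Finset.sum_add_distrib, Finset.sum_ite_eq' _ _ _,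
    if_pos (Finset.mem_univ _), ← Finset.sum_filter, Finset.sum_const, smul_eq_mul,
    Nat.card_eq_fintype_card, Fintype.card_subtype]

theorem natCard_notMem_span_add [Finite F] [Module.Finite F V] {k : ℕ}
    {v : Fin k → V} (hv : LinearIndependent F v) :
    Nat.card {u : V // u ∉ Submodule.span F (Set.range v)} + Nat.card F ^ k =
      Nat.card F ^ Module.finrank F V := by
  classical
  have : Finite V := Module.finite_of_finite F
  have h1 := Module.natCard_eq_pow_finrank (K := F) (V := Submodule.span F (Set.range v))
  rw [finrank_span_eq_card hv, Fintype.card_fin] at h1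
  rw [← h1, ← Module.natCard_eq_pow_finrank (K := F) (V := V), add_comm, ← Nat.card_sum]
  exact Nat.card_congr (Equiv.sumCompl fun u => u ∈ Submodule.span F (Set.range v))

/-- Induction on the codimension `d`. With `x = |F|` and `n = dim V`, the step is `x^(k+1) x^(nd) +
(x^n - x^(k+1)) x^(nd) = x^(n(d+1))`: the first term counts `A v_k = 0`, the second the tuples
extended by `A v_k`. -/
theorem natCard_isNilpotentShift [Finite F] [Module.Finite F V]
    (hN : ∀ (d : ℕ) (C : Submodule F V), d < Module.finrank F V → Module.finrank F C = d →
      Nat.card {D : Module.End F C // IsNilpotent D} = Nat.card F ^ (d * (d - 1)))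
    (d : ℕ) {k : ℕ} (hd : Module.finrank F V = k + 1 + d)
    {v : Fin (k + 1) → V} (hv : LinearIndependent F v) :
    Nat.card {A : Module.End F V // IsNilpotentShift v A} =
      Nat.card F ^ (Module.finrank F V * d) := by
  have hZ {k d : ℕ} (hd : Module.finrank F V = k + 1 + d) {v : Fin (k + 1) → V}
      (hv : LinearIndependent F v) :=
    natCard_isNilpotentShift_last_eq_zero hd (fun C hC => hN d C (by omega) hC) hv
  induction d generalizing k with
  | zero =>
    have htop : Submodule.span F (Set.range v) = ⊤ :=
      hv.span_eq_top_of_card_eq_finrank (by simp [hd])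
    rw [natCard_isNilpotentShift_eq_add hv 0 (by simp [htop]), hZ hd hv]
    simp
  | succ d ih =>
    rw [natCard_isNilpotentShift_eq_add hv (Nat.card F ^ (Module.finrank F V * d)), hZ hd hv]
    · have h2 : (d + 1) * (k + 1) + (d + 1) * (d + 1 - 1) = (k + 1) + Module.finrank F V * d := by
        rw [hd, Nat.add_sub_cancel]
        ring
      rw [h2, pow_add, ← add_mul, add_comm, natCard_notMem_span_add hv, ← pow_add]
      congr 1
      ring
    · intro u hu
      rw [← ih (by omega) (hv.finSnoc hu)]
      exact Nat.card_congr (Equiv.subtypeEquivRight fun A => (isNilpotentShift_snoc_iff u).symm)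

/-- The number of nilpotent endomorphisms of a vector space of dimension `n` over a field with `r`
elements is `r ^ (n (n - 1))`. -/
theorem natCard_isNilpotent_end [Finite F] (n : ℕ) (V : Type*) [AddCommGroup V] [Module F V]
    [Module.Finite F V] (hn : Module.finrank F V = n) :
    Nat.card {A : Module.End F V // IsNilpotent A} = Nat.card F ^ (n * (n - 1)) := by
  induction n using Nat.strong_induction_on generalizing V with
  | _ n ih =>
  cases n with
  | zero =>
    have : Subsingleton V := Module.finrank_zero_iff.1 hn
    have : Unique {A : Module.End F V // IsNilpotent A} :=
      ⟨⟨0, IsNilpotent.zero⟩, fun A => Subtype.ext (Subsingleton.elim _ _)⟩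
    simp
  | succ n =>
    have : Nontrivial V := Module.nontrivial_of_finrank_pos (R := F) (by omega)
    obtain ⟨x, hx⟩ := exists_ne (0 : V)
    have hv : LinearIndependent F (fun _ : Fin 1 => x) :=
      linearIndependent_unique_iff.2 hx
    -- For a one-vector tuple the shift condition is empty, so all nilpotent endomorphisms are
    -- counted.
    have h := natCard_isNilpotentShift (fun d C hd hC => ih d (hn ▸ hd) C hC) n (k := 0) (by omega) hv
    rw [hn] at h
    rw [Nat.add_sub_cancel, ← h]
    exact Nat.card_congr (Equiv.subtypeEquivRight fun A => by simp [IsNilpotentShift])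

theorem natCard_isUnipotent [Finite F] (n : ℕ) :
    Nat.card {g : Matrix.GeneralLinearGroup (Fin n) F // IsUnipotent g} =
      Nat.card F ^ (n ^ 2 - n) := by
  have h := natCard_isNilpotent_end n (Fin n → F) (Module.finrank_fin_fun F)
  rw [show n ^ 2 - n = n * (n - 1) by rw [Nat.mul_sub_one, sq], ← h]
  let e : Matrix (Fin n) (Fin n) F ≃ₐ[F] Module.End F (Fin n → F) := Matrix.toLinAlgEquiv'
  refine Nat.card_congr
    { toFun := fun g => ⟨e ((g.1 : Matrix (Fin n) (Fin n) F) - 1), g.2.map e⟩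
      invFun := fun A => ⟨(((A.2.map e.symm).isUnit_add_one)).unit, by
        simpa [IsUnipotent] using A.2.map e.symm⟩
      left_inv := fun g => by
        ext1
        ext1
        simp
      right_inv := fun A => by
        ext1
        simp }

end Nilpotent

/-! ### Counting Jordan tuples -/

section Tuples

theorem natCard_prod_subtype {α β : Type*} [Finite α] [Finite β] (P : α → Prop)
    (Q : α → β → Prop) (c : ℚ) (h : ∀ a, P a → (Nat.card {b // Q a b} : ℚ) = c) :
    (Nat.card {x : α × β // P x.1 ∧ Q x.1 x.2} : ℚ) = Nat.card {a // P a} * c := by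
  classical
  have : Fintype α := Fintype.ofFinite α
  rw [Nat.card_congr (Equiv.subtypeProdEquivSigmaSubtype fun a b => P a ∧ Q a b), Nat.card_sigma,
    Nat.cast_sum]
  have h1 (a : α) : (Nat.card {b // P a ∧ Q a b} : ℚ) = if P a then c else 0 := by
    split_ifs with ha
    · simp [ha, h a ha]
    · simp [ha]
  rw [Finset.sum_congr rfl fun a _ => h1 a, ← Finset.sum_filter, Finset.sum_const, nsmul_eq_mul,
    Nat.card_eq_fintype_card, Fintype.card_subtype]

variable {F : Type*} [Field F] {V : Type*} [AddCommGroup V] [Module F V]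

theorem finrank_comap_eq [Module.Finite F V] (f : Module.End F V) (U : Submodule F V)
    (hU : U ≤ LinearMap.range f) :
    Module.finrank F (U.comap f) = Module.finrank F U + Module.finrank F (LinearMap.ker f) := by
  have h := LinearMap.finrank_range_add_finrank_ker (f.domRestrict (U.comap f))
  have hle : LinearMap.ker f ≤ U.comap f := by
    rw [← Submodule.comap_bot]
    exact Submodule.comap_mono bot_le
  rw [LinearMap.range_domRestrict, Submodule.map_comap_eq_of_le hU, LinearMap.ker_domRestrict,
    (Submodule.comapSubtypeEquivOfLe hle).finrank_eq] at h
  exact h.symm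

/-- The excluded vectors form the preimage of `U` under `N^m`. Its dimension is `dim ker N^m + dim
U` since `U` lies in the range, and it sits in `ker N^(m+1)` since `N` kills `U`. -/
theorem natCard_ker_pow_notMem_add [Finite F] [Module.Finite F V] (N : Module.End F V) (m : ℕ)
    (U : Submodule F V) (hU : U ≤ LinearMap.range (N ^ m)) (hU' : U ≤ LinearMap.ker N) :
    Nat.card {v : V // v ∈ LinearMap.ker (N ^ (m + 1)) ∧ (N ^ m) v ∉ U} +
        Nat.card F ^ (Module.finrank F (LinearMap.ker (N ^ m)) + Module.finrank F U) =
      Nat.card F ^ Module.finrank F (LinearMap.ker (N ^ (m + 1))) := by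
  classical
  have : Finite V := Module.finite_of_finite F
  rw [add_comm (Module.finrank F _), ← finrank_comap_eq _ _ hU, ← Module.natCard_eq_pow_finrank,
    ← Module.natCard_eq_pow_finrank, add_comm]
  have h1 : U.comap (N ^ m) ≤ LinearMap.ker (N ^ (m + 1)) := fun v hv => by
    rw [LinearMap.mem_ker, pow_succ', Module.End.mul_apply]
    exact hU' hv
  rw [← Nat.card_congr (Equiv.sumCompl
      fun v : LinearMap.ker (N ^ (m + 1)) => (N ^ m) v.1 ∈ U), Nat.card_sum]
  congr 1
  · exact Nat.card_congr
      { toFun := fun v => ⟨⟨v.1, h1 v.2⟩, v.2⟩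
        invFun := fun v => ⟨v.1.1, v.2⟩
        left_inv := fun _ => rfl
        right_inv := fun _ => rfl }
  · exact (Nat.card_congr (Equiv.subtypeSubtypeEquivSubtypeInter
      (fun v => v ∈ LinearMap.ker (N ^ (m + 1))) fun v => (N ^ m) v ∉ U)).symm

/-- The vectors `s i` are killed by `N ^ (m i)`, and the vectors `N ^ (m i - 1) (s i)` are linearly
independent. -/
def IsJordanTuple (N : Module.End F V) {k : ℕ} (m : Fin k → ℕ) (s : Fin k → V) : Prop :=
  (∀ i, s i ∈ LinearMap.ker (N ^ m i)) ∧ LinearIndependent F fun i => (N ^ (m i - 1)) (s i)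

theorem isJordanTuple_snoc_iff (N : Module.End F V) {k : ℕ} (m : Fin (k + 1) → ℕ) (s : Fin k → V)
    (v : V) : IsJordanTuple N m (Fin.snoc s v : Fin (k + 1) → V) ↔
      IsJordanTuple N (fun i => m i.castSucc) s ∧ v ∈ LinearMap.ker (N ^ m (Fin.last k)) ∧
        (N ^ (m (Fin.last k) - 1)) v ∉
          Submodule.span F (Set.range fun i => (N ^ (m i.castSucc - 1)) (s i)) := by
  have h : (fun i => (N ^ (m i - 1)) ((Fin.snoc s v : Fin (k + 1) → V) i))
      = Fin.snoc (fun i => (N ^ (m i.castSucc - 1)) (s i)) ((N ^ (m (Fin.last k) - 1)) v) := by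
    funext i
    induction i using Fin.lastCases <;> simp
  rw [IsJordanTuple, IsJordanTuple, h, linearIndependent_finSnoc, Fin.forall_fin_succ']
  simp only [Fin.snoc_castSucc, Fin.snoc_last]
  tauto

theorem natCard_isJordanTuple [Finite F] [Module.Finite F V] (N : Module.End F V) {k : ℕ}
    (m : Fin k → ℕ) (hm : Antitone m) (hpos : ∀ i, 0 < m i) :
    (Nat.card {s : Fin k → V // IsJordanTuple N m s} : ℚ) =
      ∏ i, ((Nat.card F : ℚ) ^ Module.finrank F (LinearMap.ker (N ^ m i)) -
        (Nat.card F : ℚ) ^ (Module.finrank F (LinearMap.ker (N ^ (m i - 1))) + (i : ℕ))) := by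
  have : Finite V := Module.finite_of_finite F
  induction k with
  | zero =>
    have : Unique {s : Fin 0 → V // IsJordanTuple N m s} :=
      { default := ⟨Fin.elim0, fun i => i.elim0, linearIndependent_empty_type⟩
        uniq := fun s => Subtype.ext (Subsingleton.elim _ _) }
    simp
  | succ k ih =>
    obtain ⟨l, hl⟩ : ∃ l, m (Fin.last k) = l + 1 := Nat.exists_eq_succ_of_ne_zero (hpos _).ne'
    have hstep (s : Fin k → V) (hs : IsJordanTuple N (fun i => m i.castSucc) s) :
        (Nat.card {v : V // v ∈ LinearMap.ker (N ^ m (Fin.last k)) ∧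
          (N ^ (m (Fin.last k) - 1)) v ∉
            Submodule.span F (Set.range fun i => (N ^ (m i.castSucc - 1)) (s i))} : ℚ) =
        (Nat.card F : ℚ) ^ Module.finrank F (LinearMap.ker (N ^ m (Fin.last k))) -
        (Nat.card F : ℚ) ^
          (Module.finrank F (LinearMap.ker (N ^ (m (Fin.last k) - 1))) + k) := by
      rw [eq_sub_iff_add_eq]
      have h := natCard_ker_pow_notMem_add N l
        (Submodule.span F (Set.range fun i => (N ^ (m i.castSucc - 1)) (s i))) ?_ ?_
      · rw [finrank_span_eq_card hs.2, Fintype.card_fin] at h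
        rw [hl]
        exact_mod_cast h
      · rw [Submodule.span_le]
        rintro _ ⟨i, rfl⟩
        -- Decreasing sizes put the earlier vectors `N^(m i - 1) (s i)` in the range of `N^l`.
        have hle : l ≤ m i.castSucc - 1 := by
          have := hm (Fin.le_last i.castSucc)
          omega
        obtain ⟨d, hd⟩ := Nat.exists_eq_add_of_le hle
        refine ⟨(N ^ d) (s i), ?_⟩
        simp only [← Module.End.mul_apply, ← pow_add, hd]
      · rw [Submodule.span_le]
        rintro _ ⟨i, rfl⟩
        have h1 : s i ∈ LinearMap.ker (N ^ m i.castSucc) := hs.1 i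
        have h2 : m i.castSucc = m i.castSucc - 1 + 1 := by
          have := hpos i.castSucc
          omega
        rw [LinearMap.mem_ker, h2, pow_succ', Module.End.mul_apply] at h1
        exact h1
    have h := natCard_prod_subtype (IsJordanTuple N fun i => m i.castSucc) (fun s v =>
      v ∈ LinearMap.ker (N ^ m (Fin.last k)) ∧ (N ^ (m (Fin.last k) - 1)) v ∉
        Submodule.span F (Set.range fun i => (N ^ (m i.castSucc - 1)) (s i))) _ hstep
    have e : {s : Fin (k + 1) → V // IsJordanTuple N m s} ≃
        {x : (Fin k → V) × V // IsJordanTuple N (fun i => m i.castSucc) x.1 ∧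
          x.2 ∈ LinearMap.ker (N ^ m (Fin.last k)) ∧ (N ^ (m (Fin.last k) - 1)) x.2 ∉
            Submodule.span F (Set.range fun i => (N ^ (m i.castSucc - 1)) (x.1 i))} :=
      { toFun := fun s => ⟨(Fin.init s.1, s.1 (Fin.last k)), by
          rw [← isJordanTuple_snoc_iff, Fin.snoc_init_self]
          exact s.2⟩
        invFun := fun x => ⟨Fin.snoc x.1.1 x.1.2, (isJordanTuple_snoc_iff N m _ _).2 x.2⟩
        left_inv := fun s => by simp
        right_inv := fun x => by simp }
    rw [Nat.card_congr e, h, Fin.prod_univ_castSucc,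
      ih (fun i => m i.castSucc) (hm.comp_monotone Fin.strictMono_castSucc.monotone) fun i => hpos _]
    simp only [Fin.val_castSucc, Fin.val_last]

end Tuples

/-! ### The combinatorics of the order of the centralizer -/

section ListProd

theorem sum_min_eq_add_count {a : ℕ} (ha : 0 < a) (l : List ℕ) (h : ∀ b ∈ l, b ≤ a) :
    (l.map (min a)).sum = (l.map (min (a - 1))).sum + l.count a := by
  induction l with
  | nil => simp
  | cons b l ih =>
    have hb := h b (by simp)
    have ih := ih fun c hc => h c (by simp [hc])
    simp only [List.map_cons, List.sum_cons, List.count_cons, ih, beq_iff_eq]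
    split_ifs <;> omega

/-- Lowering `l[i]` by one lowers `min l[i] b` exactly for `b ≥ l[i]`: these are the `i` earlier
entries and the entries equal to `l[i]` from position `i` on. -/
theorem sum_min_getElem_eq (l : List ℕ) (h : l.Pairwise (· ≥ ·)) (hpos : ∀ b ∈ l, 0 < b) (i : ℕ)
    (hi : i < l.length) :
    (l.map (min l[i])).sum = (l.map (min (l[i] - 1))).sum + i + (l.drop i).count l[i] := by
  induction l generalizing i with
  | nil => simp at hi
  | cons a l ih =>
    rw [List.pairwise_cons] at h
    cases i with
    | zero =>
      have := sum_min_eq_add_count (hpos a (by simp)) (a :: l) (by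
        intro b hb
        rcases List.mem_cons.1 hb with rfl | hb
        · exact le_rfl
        · exact h.1 b hb)
      simpa using this
    | succ i =>
      have hi' : i < l.length := by simpa using hi
      have h1 := ih h.2 (fun b hb => hpos b (by simp [hb])) i hi'
      have h2 := h.1 l[i] (List.getElem_mem hi')
      have h3 := hpos l[i] (by simp [List.getElem_mem hi'])
      simp only [List.getElem_cons_succ, List.map_cons, List.sum_cons, List.drop_succ_cons, h1]
      omega

/-- Over the occurrences of a value of multiplicity `m`, the number of occurrences still ahead, the
current one included, runs through `m, …, 1`. -/
theorem prod_one_sub_pow_count {A : Type*} [CommRing A] (l : List ℕ) (x : A) :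
    ∏ i : Fin l.length, (1 - x ^ (l.drop i).count (l.get i)) = phiProd (l : Multiset ℕ) x := by
  induction l with
  | nil => simp [phiProd]
  | cons a l ih =>
    rw [← Multiset.cons_coe, phiProd_cons, ← ih, mul_comm]
    simp only [List.length_cons, Fin.prod_univ_succ]
    simp

theorem sum_sum_min_eq_pairMin (l : List ℕ) :
    ∑ i : Fin l.length, (l.map (min (l.get i))).sum = pairMin (l : Multiset ℕ) := by
  have h (f : ℕ → ℕ) : ∑ i : Fin l.length, f (l.get i) = (l.map f).sum := by
    rw [← List.sum_ofFn]
    conv_rhs => rw [← List.ofFn_get l, List.map_ofFn]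
    rfl
  simpa [pairMin] using h fun a => (l.map (min a)).sum

theorem prod_sub_eq (l : List ℕ) (h : l.Pairwise (· ≥ ·)) (hpos : ∀ b ∈ l, 0 < b) {K : Type*}
    [Field K] {x : K} (hx : x ≠ 0) :
    ∏ i : Fin l.length, (x ^ (l.map (min (l.get i))).sum -
        x ^ ((l.map (min (l.get i - 1))).sum + (i : ℕ)))
      = x ^ pairMin (l : Multiset ℕ) * phiProd (l : Multiset ℕ) x⁻¹ := by
  rw [← prod_one_sub_pow_count, ← sum_sum_min_eq_pairMin, ← Finset.prod_pow_eq_pow_sum,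
    ← Finset.prod_mul_distrib]
  refine Finset.prod_congr rfl fun i _ => ?_
  have h1 := sum_min_getElem_eq l h hpos i i.2
  rw [mul_sub, mul_one]
  congr 1
  simp only [List.get_eq_getElem] at h1 ⊢
  rw [h1, pow_add x (_ + _), mul_assoc, ← mul_pow, mul_inv_cancel₀ hx, one_pow, mul_one]

end ListProd

/-! ### The centralizer of a direct sum of Jordan blocks -/

section Shift

variable {F : Type*} [Field F] {ℓ : ℕ} (m : Fin ℓ → ℕ)

variable (F) in
/-- The direct sum of the nilpotent Jordan blocks of sizes `m i`. -/
def jordanShift : Module.End F ((Σ i, Fin (m i)) → F) where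
  toFun f x := if h : (x.2 : ℕ) + 1 < m x.1 then f ⟨x.1, ⟨x.2 + 1, h⟩⟩ else 0
  map_add' f g := by
    funext x
    simp only [Pi.add_apply]
    split_ifs <;> simp
  map_smul' c f := by
    funext x
    simp only [Pi.smul_apply, RingHom.id_apply]
    split_ifs <;> simp

variable {m}

theorem jordanShift_pow_apply (k : ℕ) (f : (Σ i, Fin (m i)) → F) (x : Σ i, Fin (m i)) :
    (jordanShift F m ^ k) f x
      = if h : (x.2 : ℕ) + k < m x.1 then f ⟨x.1, ⟨x.2 + k, h⟩⟩ else 0 := by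
  induction k generalizing x with
  | zero => simp
  | succ k ih =>
    rw [pow_succ', Module.End.mul_apply]
    change (if h : (x.2 : ℕ) + 1 < m x.1 then
      (jordanShift F m ^ k) f ⟨x.1, ⟨x.2 + 1, h⟩⟩ else 0) = _
    by_cases h : (x.2 : ℕ) + 1 < m x.1
    · rw [dif_pos h, ih]
      simp only [show (x.2 : ℕ) + 1 + k = x.2 + (k + 1) by omega]
    · rw [dif_neg h, dif_neg (by omega)]

theorem jordanShift_pow_single (k : ℕ) (i : Fin ℓ) (j : Fin (m i)) :
    (jordanShift F m ^ k) (Pi.single ⟨i, j⟩ 1)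
      = if k ≤ (j : ℕ) then Pi.single ⟨i, ⟨j - k, by omega⟩⟩ 1 else 0 := by
  funext ⟨i', j'⟩
  rw [jordanShift_pow_apply]
  by_cases hi : i' = i
  · subst hi
    split_ifs with h1 h2 h2 <;>
      simp only [Pi.single_apply, Sigma.mk.injEq, heq_eq_eq, true_and, Fin.ext_iff, Pi.zero_apply]
    · congr 1
      apply propext
      omega
    · rw [if_neg (by omega)]
    · have := j.2
      simp only at h1
      rw [if_neg (by omega)]
  · split_ifs <;> simp [hi]

theorem mem_ker_jordanShift_pow {k : ℕ} {f : (Σ i, Fin (m i)) → F} :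
    f ∈ LinearMap.ker (jordanShift F m ^ k) ↔ ∀ x, k ≤ (x.2 : ℕ) → f x = 0 := by
  rw [LinearMap.mem_ker]
  constructor
  · rintro h ⟨i, j⟩ hk
    have h1 := congrFun h ⟨i, ⟨j - k, by omega⟩⟩
    rw [jordanShift_pow_apply, dif_pos (by simp only; simp only at hk; omega)] at h1
    simp only [Pi.zero_apply] at h1 hk
    rw [← h1]
    congr 2
    ext
    simp only
    omega
  · intro h
    funext x
    rw [jordanShift_pow_apply]
    split_ifs
    · exact h _ (by simp)
    · rfl

theorem finrank_ker_jordanShift_pow (k : ℕ) :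
    Module.finrank F (LinearMap.ker (jordanShift F m ^ k)) = ∑ i, min k (m i) := by
  classical
  let I : Set (Σ i, Fin (m i)) := {x | (x.2 : ℕ) < k}
  have h1 : LinearMap.ker (jordanShift F m ^ k)
      = ⨅ x ∈ Iᶜ, LinearMap.ker (LinearMap.proj x : ((Σ i, Fin (m i)) → F) →ₗ[F] F) := by
    ext f
    rw [mem_ker_jordanShift_pow]
    simp [I]
  rw [h1, (LinearMap.iInfKerProjEquiv F (fun _ : Σ i, Fin (m i) => F) (I := I) (J := Iᶜ)
    disjoint_compl_right (by simp)).finrank_eq, Module.finrank_fintype_fun_eq_card]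
  have h2 : Fintype.card I = ∑ x : Σ i, Fin (m i), if (x.2 : ℕ) < k then 1 else 0 := by
    rw [← Finset.card_filter, Fintype.card_subtype]
    rfl
  rw [h2, Fintype.sum_sigma]
  refine Finset.sum_congr rfl fun i _ => ?_
  rw [Fin.sum_univ_eq_sum_range fun j => if j < k then 1 else 0, ← Finset.card_filter]
  rw [show (Finset.range (m i)).filter (· < k) = Finset.range (min k (m i)) by ext; simp; omega,
    Finset.card_range]

/-- Applying `N` repeatedly to a nonzero vector of `ker A` stays in `ker A` and ends with a nonzero
vector of `ker A ∩ ker N`. -/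
theorem injective_of_injOn_ker {V : Type*} [AddCommGroup V] [Module F V] {A N : Module.End F V}
    (hN : IsNilpotent N) (hc : Commute A N) (h : ∀ x, N x = 0 → A x = 0 → x = 0) :
    LinearMap.ker A = ⊥ := by
  obtain ⟨l, hl⟩ := hN
  have h1 (k : ℕ) (x : V) (hk : (N ^ k) x = 0) (hx : A x = 0) : x = 0 := by
    induction k generalizing x with
    | zero => simpa using hk
    | succ k ih =>
      refine h x (ih (N x) ?_ ?_) hx
      · rwa [pow_succ, Module.End.mul_apply] at hk
      · rw [← Module.End.mul_apply, hc.eq, Module.End.mul_apply, hx, map_zero]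
  rw [LinearMap.ker_eq_bot']
  exact fun x hx => h1 l x (by rw [hl]; rfl) hx

theorem isNilpotent_jordanShift : IsNilpotent (jordanShift F m) := by
  refine ⟨∑ i, m i, LinearMap.ext fun f => ?_⟩
  rw [LinearMap.zero_apply, ← LinearMap.mem_ker, mem_ker_jordanShift_pow]
  intro x hx
  have := Finset.single_le_sum (f := m) (fun i _ => Nat.zero_le _) (Finset.mem_univ x.1)
  have := x.2.2
  omega

/-- The linear map sending the generators of the Jordan blocks to the vectors `s i`. -/
noncomputable def jordanLift (s : Fin ℓ → (Σ i, Fin (m i)) → F) :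
    Module.End F ((Σ i, Fin (m i)) → F) :=
  -- `jordanShift` lowers positions, so position `m i - 1` holds the generator and position `j` is
  -- its image under the power `m i - 1 - j`.
  (Pi.basisFun F (Σ i, Fin (m i))).constr F fun x =>
    (jordanShift F m ^ (m x.1 - 1 - (x.2 : ℕ))) (s x.1)

theorem jordanLift_single (s : Fin ℓ → (Σ i, Fin (m i)) → F) (x : Σ i, Fin (m i)) :
    jordanLift s (Pi.single x 1) = (jordanShift F m ^ (m x.1 - 1 - (x.2 : ℕ))) (s x.1) := by
  rw [jordanLift, ← Pi.basisFun_apply, Module.Basis.constr_basis]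

theorem end_ext_single {A B : Module.End F ((Σ i, Fin (m i)) → F)}
    (h : ∀ x, A (Pi.single x 1) = B (Pi.single x 1)) : A = B :=
  (Pi.basisFun F (Σ i, Fin (m i))).ext fun x => by simpa using h x

theorem commute_jordanLift {s : Fin ℓ → (Σ i, Fin (m i)) → F}
    (hs : ∀ i, s i ∈ LinearMap.ker (jordanShift F m ^ m i)) :
    Commute (jordanLift s) (jordanShift F m) := by
  refine end_ext_single fun ⟨i, j⟩ => ?_
  have h1 := jordanShift_pow_single (F := F) 1 i j
  rw [pow_one] at h1
  rw [Module.End.mul_apply, Module.End.mul_apply, h1, jordanLift_single, ← Module.End.mul_apply,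
    ← pow_succ']
  simp only
  split_ifs with h
  · rw [jordanLift_single]
    congr 2
    simp only
    omega
  · rw [map_zero, show m i - 1 - (j : ℕ) + 1 = m i by omega]
    exact (hs i).symm

/-- It suffices to test injectivity on `ker N`, spanned by the basis vectors at position `0`; their
images are the independent vectors `N^(m i - 1) (s i)`. -/
theorem isUnit_jordanLift {s : Fin ℓ → (Σ i, Fin (m i)) → F} (hpos : ∀ i, 0 < m i)
    (hs : IsJordanTuple (jordanShift F m) m s) : IsUnit (jordanLift s) := by
  rw [LinearMap.isUnit_iff_ker_eq_bot]
  refine injective_of_injOn_ker isNilpotent_jordanShift (commute_jordanLift hs.1) fun f hf hA => ?_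
  rw [← pow_one (jordanShift F m), ← LinearMap.mem_ker, mem_ker_jordanShift_pow] at hf
  have h1 : jordanLift s f
      = ∑ i, f ⟨i, ⟨0, hpos i⟩⟩ • (jordanShift F m ^ (m i - 1)) (s i) := by
    conv_lhs => rw [← (Pi.basisFun F (Σ i, Fin (m i))).sum_repr f]
    rw [map_sum, Fintype.sum_sigma]
    refine Finset.sum_congr rfl fun i _ => ?_
    rw [Finset.sum_eq_single ⟨0, hpos i⟩]
    · simp [jordanLift_single]
    · intro j _ hj
      have : 1 ≤ (j : ℕ) := Nat.one_le_iff_ne_zero.2 fun h => hj (Fin.ext h)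
      simp [hf ⟨i, j⟩ this]
    · simp
  rw [h1] at hA
  have h2 := Fintype.linearIndependent_iff.1 hs.2 _ hA
  funext ⟨i, j⟩
  rcases Nat.eq_zero_or_pos (j : ℕ) with hj | hj
  · rw [show j = ⟨0, hpos i⟩ from Fin.ext hj]
    exact h2 i
  · exact hf ⟨i, j⟩ hj

theorem isJordanTuple_of_isUnit {A : Module.End F ((Σ i, Fin (m i)) → F)} (hpos : ∀ i, 0 < m i)
    (hA : IsUnit A) (hc : Commute A (jordanShift F m)) :
    IsJordanTuple (jordanShift F m) m fun i =>
      A (Pi.single ⟨i, ⟨m i - 1, Nat.sub_lt (hpos i) one_pos⟩⟩ 1) := by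
  have hAN (k : ℕ) (f : (Σ i, Fin (m i)) → F) :
      (jordanShift F m ^ k) (A f) = A ((jordanShift F m ^ k) f) := by
    rw [← Module.End.mul_apply, ← (hc.pow_right k).eq, Module.End.mul_apply]
  refine ⟨fun i => ?_, ?_⟩
  · rw [LinearMap.mem_ker, hAN, jordanShift_pow_single, if_neg, map_zero]
    have := hpos i
    simp only
    omega
  · have h1 (i : Fin ℓ) : (jordanShift F m ^ (m i - 1))
        (A (Pi.single ⟨i, ⟨m i - 1, Nat.sub_lt (hpos i) one_pos⟩⟩ 1))
        = A (Pi.basisFun F (Σ i, Fin (m i)) ⟨i, ⟨0, hpos i⟩⟩) := by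
      rw [hAN, jordanShift_pow_single, if_pos le_rfl, Pi.basisFun_apply]
      simp
    simp only [h1]
    have h2 := (Pi.basisFun F (Σ i, Fin (m i))).linearIndependent.comp
      (fun i : Fin ℓ => (⟨i, ⟨0, hpos i⟩⟩ : Σ i, Fin (m i))) fun i i' h => congrArg Sigma.fst h
    exact h2.map' A ((LinearMap.isUnit_iff_ker_eq_bot A).1 hA)

/-- Automorphisms commuting with a nilpotent Jordan matrix correspond to Jordan tuples. -/
noncomputable def jordanTupleEquiv (hpos : ∀ i, 0 < m i) :
    {A : Module.End F ((Σ i, Fin (m i)) → F) // IsUnit A ∧ Commute A (jordanShift F m)} ≃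
      {s : Fin ℓ → (Σ i, Fin (m i)) → F // IsJordanTuple (jordanShift F m) m s} where
  toFun A := ⟨_, isJordanTuple_of_isUnit hpos A.2.1 A.2.2⟩
  invFun s := ⟨jordanLift s.1, isUnit_jordanLift hpos s.2, commute_jordanLift s.2.1⟩
  left_inv A := by
    ext1
    refine end_ext_single fun ⟨i, j⟩ => ?_
    rw [jordanLift_single]
    simp only
    rw [← Module.End.mul_apply, ← (A.2.2.pow_right _).eq, Module.End.mul_apply,
      jordanShift_pow_single, if_pos (by simp only; omega)]
    congr 4
    simp only
    omega
  right_inv s := by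
    ext1
    funext i
    simp [jordanLift_single]

theorem natCard_commute_jordanShift [Finite F] (hm : Antitone m) (hpos : ∀ i, 0 < m i) :
    (Nat.card {A : Module.End F ((Σ i, Fin (m i)) → F) //
        IsUnit A ∧ Commute A (jordanShift F m)} : ℚ) =
      ∏ i, ((Nat.card F : ℚ) ^ (∑ i', min (m i) (m i')) -
        (Nat.card F : ℚ) ^ ((∑ i', min (m i - 1) (m i')) + (i : ℕ))) := by
  rw [Nat.card_congr (jordanTupleEquiv hpos), natCard_isJordanTuple _ m hm hpos]
  simp only [finrank_ker_jordanShift_pow]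

end Shift

/-! ### Transport to centralizers in `GL_n(F)` -/

section Centralizer

theorem natCard_centralizer_eq {M M' : Type*} [Monoid M] [Monoid M'] (Φ : M ≃* M') (g : Mˣ) :
    Nat.card (Subgroup.centralizer {g}) = Nat.card {A : M' // IsUnit A ∧ Commute A (Φ g)} := by
  refine Nat.card_congr
    { toFun := fun h => ⟨Φ h.1, (Units.isUnit h.1).map Φ, ?_⟩
      invFun := fun A => ⟨(A.2.1.map Φ.symm).unit, ?_⟩
      left_inv := fun h => by
        ext
        simp
      right_inv := fun A => by
        ext
        simp }
  · have := Subgroup.mem_centralizer_singleton_iff.1 h.2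
    have h1 := congrArg Units.val this
    have h2 : Commute (h.1 : M) g := by simpa [Commute, SemiconjBy] using h1
    exact h2.map Φ
  · rw [Subgroup.mem_centralizer_singleton_iff]
    ext
    have h1 : Commute (Φ.symm A.1) (Φ.symm (Φ g)) := A.2.2.map Φ.symm
    rw [Φ.symm_apply_apply] at h1
    simpa using h1.eq

/-- Conjugation by a unit, as a multiplicative automorphism of a monoid. -/
def unitConj {M : Type*} [Monoid M] (u : Mˣ) : M ≃* M where
  toFun x := u * x * ((u⁻¹ : Mˣ) : M)
  invFun x := ((u⁻¹ : Mˣ) : M) * x * u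
  left_inv x := by simp [mul_assoc]
  right_inv x := by simp [mul_assoc]
  map_mul' x y := by simp [mul_assoc]

theorem toLin_jordanMatrix {F : Type*} [Field F] {n : ℕ} (p : n.Partition) :
    Matrix.toLin' (jordanMatrix F p) = 1 + jordanShift F (sortedParts p).get := by
  refine LinearMap.ext fun f => funext fun ⟨i, j⟩ => ?_
  rw [Matrix.toLin'_apply, jordanMatrix, Matrix.mulVec, dotProduct, Fintype.sum_sigma,
    Finset.sum_eq_single i]
  · simp only [Matrix.blockDiagonal'_apply_eq, jordanBlock, Matrix.of_apply]
    have h1 := jordanShift_pow_apply (F := F) (m := (sortedParts p).get) 1 f ⟨i, j⟩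
    rw [pow_one] at h1
    rw [LinearMap.add_apply, Pi.add_apply, h1, Module.End.one_apply]
    have h2 (j' : Fin ((sortedParts p).get i)) :
        (if j = j' ∨ (j : ℕ) + 1 = j' then (1 : F) else 0) * f ⟨i, j'⟩
          = (if j = j' then f ⟨i, j'⟩ else 0) + if (j : ℕ) + 1 = j' then f ⟨i, j'⟩ else 0 := by
      by_cases h : j = j'
      · subst h
        simp
      · simp [h]
    rw [Finset.sum_congr rfl fun j' _ => h2 j', Finset.sum_add_distrib, Finset.sum_ite_eq,
      if_pos (Finset.mem_univ _)]
    congr 1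
    split_ifs with h
    · rw [Finset.sum_eq_single ⟨j + 1, h⟩]
      · simp
      · intro j' _ hj'
        rw [if_neg fun h' => hj' (Fin.ext h'.symm)]
      · simp
    · refine Finset.sum_eq_zero fun j' _ => ?_
      have := j'.2
      rw [if_neg (by simp only at h; omega)]
  · intro i' _ hi
    refine Finset.sum_eq_zero fun j' _ => ?_
    rw [Matrix.blockDiagonal'_apply_ne _ _ _ hi.symm, zero_mul]
  · simp

theorem natCard_centralizer_of_isUnipotentOfType {F : Type*} [Field F] [Finite F] {n : ℕ}
    (p : n.Partition) (g : Matrix.GeneralLinearGroup (Fin n) F) (hg : IsUnipotentOfType g p) :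
    (Nat.card (Subgroup.centralizer {g}) : ℚ) = aPart p (cardUnit F) := by
  obtain ⟨e, P, hP⟩ := hg
  -- `Φ` undoes the conjugation by `P` and the numbering `e`, then passes to endomorphisms, so that
  -- `g` becomes `1 + jordanShift`.
  let Φ := ((unitConj P).symm.trans (Matrix.reindexAlgEquiv F F e.symm).toMulEquiv).trans
    (Matrix.toLinAlgEquiv' (R := F)).toMulEquiv
  have hΦ : Φ g = 1 + jordanShift F (sortedParts p).get := by
    have h1 : (unitConj P).symm (g : Matrix (Fin n) (Fin n) F)
        = Matrix.reindex e e (jordanMatrix F p) := by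
      rw [MulEquiv.symm_apply_eq, hP]
      rfl
    rw [← toLin_jordanMatrix]
    change Matrix.toLin' (Matrix.reindex e.symm e.symm ((unitConj P).symm _)) = _
    rw [h1]
    congr 1
    ext
    simp
  have hmem (b : ℕ) (hb : b ∈ sortedParts p) : 0 < b :=
    p.parts_pos (by rw [← coe_sortedParts]; exact hb)
  have hcomm (A : Module.End F ((Σ i, Fin ((sortedParts p).get i)) → F)) :
      Commute A (1 + jordanShift F (sortedParts p).get)
        ↔ Commute A (jordanShift F (sortedParts p).get) :=
    ⟨fun h => by simpa using h.sub_right (Commute.one_right A),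
      fun h => (Commute.one_right A).add_right h⟩
  rw [natCard_centralizer_eq Φ g, hΦ]
  simp only [hcomm]
  have hF : (Nat.card F : ℚ) ≠ 0 := (cardUnit F).ne_zero
  have hsum (a : ℕ) : ∑ i', min a ((sortedParts p).get i')
      = ((sortedParts p).map (min a)).sum := by
    rw [← List.sum_ofFn]
    conv_rhs => rw [← List.ofFn_get (sortedParts p), List.map_ofFn]
    rfl
  have hanti : Antitone (sortedParts p).get :=
    (pairwise_sortedParts p).sortedGE.antitone_get
  rw [natCard_commute_jordanShift hanti fun i => hmem _ (List.get_mem _ _)]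
  simp only [hsum]
  rw [prod_sub_eq _ (pairwise_sortedParts p) hmem hF, aPart_eq, coe_sortedParts]
  simp [cardUnit]

end Centralizer

end ColoringZeta

theorem mainTheorem6 :
    (∀ (F : Type*) [Field F] [Finite F] (n : ℕ) (p : n.Partition)
        (g : Matrix.GeneralLinearGroup (Fin n) F), ColoringZeta.IsUnipotentOfType g p →
        (Nat.card (Subgroup.centralizer {g}) : ℚ)
          = ColoringZeta.aPart p (ColoringZeta.cardUnit F)) ∧
    ColoringZeta.HasFormalProd
      (fun n => 1 - PowerSeries.C ((ColoringZeta.q : ColoringZeta.R) ^ n) * PowerSeries.X)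
      ColoringZeta.centralizerData.zetaPoint ∧
    ColoringZeta.HasFormalProd
      (fun n => 1 - PowerSeries.C ((ColoringZeta.q : ColoringZeta.R) ^ (n + 1)) * PowerSeries.X)
      ColoringZeta.eulerSeries ∧
    (∀ (F : Type*) [Field F] [Finite F] (n : ℕ),
        Nat.card {g : Matrix.GeneralLinearGroup (Fin n) F // ColoringZeta.IsUnipotent g}
          = Nat.card F ^ (n ^ 2 - n)) :=
  ⟨fun _ _ _ _ p g hg => ColoringZeta.natCard_centralizer_of_isUnipotentOfType p g hg,
    ColoringZeta.hasFormalProd_zetaPoint, ColoringZeta.hasFormalProd_eulerSeries,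
    fun _ _ _ n => ColoringZeta.natCard_isUnipotent n⟩
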